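/- For $n\in\mathbb N$, an \emph{$n$-town} is a set $S\subset\mathbb Z\times\mathbb Z$ of $n$ grid points; it is \emph{optimal} if its cost $c(S)=\frac12\sum_{s\in S}\sum_{t\in S}\|s-t\|_1$ is minimum among all $n$-towns. An optimal $n$-town can be computed in $O(n^{15/2})$ time: there is a single random access machine program that, given $n$, outputs the coordinates of the points of an optimal $n$-town after $O(n^{15/2})$ elementary steps. Here an elementary step is an assignment of a constant, an addition, (cut-off) subtraction, multiplication or (rounded) division, an indirect load or store, the output of a number, or a comparison, and all numbers that occur during the computation are bounded by a fixed polynomial in $n$, i.e. they are words of $O(\log n)$ bits. -/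

import Mathlib

open Filter Asymptotics

/-! ### Towns -/

/-- The Manhattan distance of two grid points. -/
def manhattan (s t : ℤ × ℤ) : ℤ := |s.1 - t.1| + |s.2 - t.2|

/-- The cost of a finite set of grid points: half the sum of the Manhattan distances over all
ordered pairs of its points. -/
def townCost (S : Finset (ℤ × ℤ)) : ℚ :=
  (1 / 2 : ℚ) * ∑ s ∈ S, ∑ t ∈ S, (manhattan s t : ℚ)

/-- An `n`-town is a set of `n` grid points. It is optimal if no `n`-town has a smaller cost. -/
def IsOptimalTown (n : ℕ) (S : Finset (ℤ × ℤ)) : Prop :=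
  S.card = n ∧ ∀ S' : Finset (ℤ × ℤ), S'.card = n → townCost S ≤ townCost S'

/-! ### Random access machines

The machine has registers and a memory, all of whose cells hold natural numbers, and an output
tape to which numbers are appended. A program is a fixed finite command, so it names only finitely
many registers; the memory is accessed through addresses that are computed during the run. -/

/-- The arithmetic operations. -/
inductive ArithOp where
  | add
  | sub
  | mul
  | div

/-- Subtraction is cut off at `0`; division rounds down, with `x / 0 = 0`. -/
def ArithOp.eval : ArithOp → ℕ → ℕ → ℕ
  | .add, x, y => x + y
  | .sub, x, y => x - y
  | .mul, x, y => x * y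
  | .div, x, y => x / y

/-- Structured programs of a random access machine. Registers are named by natural numbers. -/
inductive RamProg where
  /-- Do nothing. -/
  | skip
  /-- `R_d := v`. -/
  | const (d v : ℕ)
  /-- `R_d := R_a ∘ R_b` for an arithmetic operation `∘`. -/
  | arith (o : ArithOp) (d a b : ℕ)
  /-- `R_d := M[R_a]`. -/
  | load (d a : ℕ)
  /-- `M[R_a] := R_b`. -/
  | store (a b : ℕ)
  /-- Append `R_a` to the output. -/
  | emit (a : ℕ)
  /-- First `p`, then `q`. -/
  | seq (p q : RamProg)
  /-- If `R_a < R_b` then `p`, else `q`. -/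
  | ifLt (a b : ℕ) (p q : RamProg)
  /-- While `R_a < R_b` do `p`. -/
  | whileLt (a b : ℕ) (p : RamProg)

/-- A state of the machine. -/
structure RamState where
  /-- The contents of the registers. -/
  reg : ℕ → ℕ
  /-- The contents of the memory cells. -/
  mem : ℕ → ℕ
  /-- The numbers that have been output so far. -/
  out : List ℕ

/-- The initial state on input `n`: register `0` holds `n`, everything else is `0`, and the output
is empty. -/
def RamState.init (n : ℕ) : RamState where
  reg := Function.update (fun _ => 0) 0 n
  mem := fun _ => 0
  out := []

/-- `RamExec B p s s' t`: started in the state `s`, the program `p` terminates in the state `s'`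
after exactly `t` elementary steps, and no number that is produced on the way exceeds `B`. Each
elementary command costs one step, and so does each evaluation of a test `R_a < R_b`. -/
inductive RamExec (B : ℕ) : RamProg → RamState → RamState → ℕ → Prop where
  | skip (s : RamState) : RamExec B .skip s s 1
  | const (s : RamState) (d v : ℕ) (h : v ≤ B) :
      RamExec B (.const d v) s { s with reg := Function.update s.reg d v } 1
  | arith (s : RamState) (o : ArithOp) (d a b : ℕ) (h : o.eval (s.reg a) (s.reg b) ≤ B) :
      RamExec B (.arith o d a b) s
        { s with reg := Function.update s.reg d (o.eval (s.reg a) (s.reg b)) } 1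
  | load (s : RamState) (d a : ℕ) :
      RamExec B (.load d a) s { s with reg := Function.update s.reg d (s.mem (s.reg a)) } 1
  | store (s : RamState) (a b : ℕ) :
      RamExec B (.store a b) s { s with mem := Function.update s.mem (s.reg a) (s.reg b) } 1
  | emit (s : RamState) (a : ℕ) :
      RamExec B (.emit a) s { s with out := s.out ++ [s.reg a] } 1
  | seq {p q : RamProg} {s s' s'' : RamState} {t t' : ℕ}
      (hp : RamExec B p s s' t) (hq : RamExec B q s' s'' t') :
      RamExec B (.seq p q) s s'' (t + t')
  | ifTrue {a b : ℕ} {p q : RamProg} {s s' : RamState} {t : ℕ}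
      (h : s.reg a < s.reg b) (hp : RamExec B p s s' t) :
      RamExec B (.ifLt a b p q) s s' (t + 1)
  | ifFalse {a b : ℕ} {p q : RamProg} {s s' : RamState} {t : ℕ}
      (h : ¬ s.reg a < s.reg b) (hq : RamExec B q s s' t) :
      RamExec B (.ifLt a b p q) s s' (t + 1)
  | whileTrue {a b : ℕ} {p : RamProg} {s s' s'' : RamState} {t t' : ℕ}
      (h : s.reg a < s.reg b) (hp : RamExec B p s s' t)
      (hw : RamExec B (.whileLt a b p) s' s'' t') :
      RamExec B (.whileLt a b p) s s'' (t + t' + 1)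
  | whileFalse {a b : ℕ} {p : RamProg} {s : RamState} (h : ¬ s.reg a < s.reg b) :
      RamExec B (.whileLt a b p) s s 1

/-- `out` lists the points of `S`, each exactly once, as `x₁, y₁, x₂, y₂, …`. -/
def ListsTown (out : List ℕ) (S : Finset (ℤ × ℤ)) : Prop :=
  ∃ L : List (ℕ × ℕ), L.Nodup ∧ out = L.flatMap (fun p => [p.1, p.2]) ∧
    S = (L.map (fun p => ((p.1 : ℤ), (p.2 : ℤ)))).toFinset

/-! Number rows and columns outwards from a centre, at the positions 0, 1, -1, 2, -2, … (`pos`).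
Compressing every column of a town towards the centre leaves the first coordinates unchanged and
does not increase the total vertical distance, since for each pair of columns centred sets of the
given sizes minimise the total distance (`sum_abs_pos_le`). Doing the same to the rows yields a
Young diagram of no larger cost (`exists_diagram`), so only such diagrams need be searched.

The distance of two positions is the number of cuts separating them, where cut `k` splits off the
indices `k, k + 2, …` (`abs_pos_sub_eq_sum`). A cut with `m` of the `n` cells on its outer side
contributes `m * (n - m)`. The cost of a diagram is therefore a sum over column cuts and row cuts
that depends only on these counts (`diagramCost_eq`).

The counts can be maintained along the boundary of the diagram, starting at the corner `(n, 0)`. The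
state `(i, g, a, b, u, v)` gives the corner `(i, n - g)`, the cells already known in the columns
from `i` on by parity, and the cells still owed by the rows from `n - g` on by parity. The row
totals are guessed at the start: `e` cells in even rows, `n - e` in odd ones. Each boundary step
closes a column or a row, settles one cut and updates the counts (`Fill`, `Fill.spec`). Every
diagram of `n` cells arises in this way (`exists_fill`), and every complete filling is a town of the
recorded cost (`Fill.town`).

A dynamic program over the `(n + 1) ^ 6` states, with constantly many machine steps per state, finds
the cheapest filling, and a traceback of at most `2 * n` boundary steps prints it. The running time
is thus `O(n ^ 6)`, below the required bound. The machine side is a time-bounded Hoare logic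
(`Achieves`) for programs written with expressions. -/

/-! ### A small language on top of the machine -/

/-- Expressions over registers, literals, arithmetic and memory reads. -/
inductive RamExp where
  | var (j : ℕ)
  | lit (v : ℕ)
  | bin (o : ArithOp) (e f : RamExp)
  | get (e : RamExp)

namespace RamExp

/-- The value of an expression. -/
def eval (s : RamState) : RamExp → ℕ
  | var j => s.reg j
  | lit v => v
  | bin o e f => o.eval (e.eval s) (f.eval s)
  | get e => s.mem (e.eval s)

/-- Evaluate an expression into register `k`, with the registers from `k` on as scratch space. -/
def code : RamExp → ℕ → RamProg
  -- There is no copy instruction, so a register is copied by adding it to zero.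
  | var j, k => .seq (.const k 0) (.arith .add k j k)
  | lit v, k => .const k v
  | bin o e f, k => .seq (e.code k) (.seq (f.code (k + 1)) (.arith o k k (k + 1)))
  | get e, k => .seq (e.code k) (.load k k)

/-- The running time of `code`. -/
def time : RamExp → ℕ
  | var _ => 2
  | lit _ => 1
  | bin _ e f => e.time + (f.time + 1)
  | get e => e.time + 1

/-- All registers that occur are below `K`. -/
def Below (K : ℕ) : RamExp → Prop
  | var j => j < K
  | lit _ => True
  | bin _ e f => e.Below K ∧ f.Below K
  | get e => e.Below K

instance decidableBelow (K : ℕ) : ∀ e : RamExp, Decidable (e.Below K)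
  | var j => inferInstanceAs (Decidable (j < K))
  | lit _ => inferInstanceAs (Decidable True)
  | bin _ e f =>
    haveI := decidableBelow K e
    haveI := decidableBelow K f
    inferInstanceAs (Decidable (e.Below K ∧ f.Below K))
  | get e => decidableBelow K e

/-- No number that is produced by the evaluation exceeds `B`. -/
def Fits (B : ℕ) (s : RamState) : RamExp → Prop
  | var j => s.reg j ≤ B
  | lit v => v ≤ B
  | bin o e f => e.Fits B s ∧ f.Fits B s ∧ o.eval (e.eval s) (f.eval s) ≤ B
  | get e => e.Fits B s

instance : Add RamExp := ⟨bin .add⟩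
instance : Sub RamExp := ⟨bin .sub⟩
instance : Mul RamExp := ⟨bin .mul⟩
instance : Div RamExp := ⟨bin .div⟩

section simpLemmas

variable (s : RamState) (B j v : ℕ) (e f : RamExp)

@[simp] theorem eval_var : (var j).eval s = s.reg j := rfl
@[simp] theorem eval_lit : (lit v).eval s = v := rfl
@[simp] theorem eval_get : (get e).eval s = s.mem (e.eval s) := rfl
@[simp] theorem eval_add : (e + f).eval s = e.eval s + f.eval s := rfl
@[simp] theorem eval_sub : (e - f).eval s = e.eval s - f.eval s := rfl
@[simp] theorem eval_mul : (e * f).eval s = e.eval s * f.eval s := rfl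
@[simp] theorem eval_div : (e / f).eval s = e.eval s / f.eval s := rfl
@[simp] theorem time_var : (var j).time = 2 := rfl
@[simp] theorem time_lit : (lit v).time = 1 := rfl
@[simp] theorem time_get : (get e).time = e.time + 1 := rfl
@[simp] theorem time_add : (e + f).time = e.time + (f.time + 1) := rfl
@[simp] theorem time_sub : (e - f).time = e.time + (f.time + 1) := rfl
@[simp] theorem time_mul : (e * f).time = e.time + (f.time + 1) := rfl
@[simp] theorem time_div : (e / f).time = e.time + (f.time + 1) := rfl
@[simp] theorem fits_var : (var j).Fits B s ↔ s.reg j ≤ B := Iff.rfl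
@[simp] theorem fits_lit : (lit v).Fits B s ↔ v ≤ B := Iff.rfl
@[simp] theorem fits_get : (get e).Fits B s ↔ e.Fits B s := Iff.rfl
@[simp] theorem fits_add : (e + f).Fits B s ↔
    e.Fits B s ∧ f.Fits B s ∧ e.eval s + f.eval s ≤ B := Iff.rfl
@[simp] theorem fits_sub : (e - f).Fits B s ↔
    e.Fits B s ∧ f.Fits B s ∧ e.eval s - f.eval s ≤ B := Iff.rfl
@[simp] theorem fits_mul : (e * f).Fits B s ↔
    e.Fits B s ∧ f.Fits B s ∧ e.eval s * f.eval s ≤ B := Iff.rfl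
@[simp] theorem fits_div : (e / f).Fits B s ↔
    e.Fits B s ∧ f.Fits B s ∧ e.eval s / f.eval s ≤ B := Iff.rfl

end simpLemmas

end RamExp

/-- The states agree apart from the registers from `K` on. -/
def RamState.Agree (K : ℕ) (s s' : RamState) : Prop :=
  (∀ j < K, s.reg j = s'.reg j) ∧ s.mem = s'.mem ∧ s.out = s'.out

theorem RamState.Agree.mono {K K' : ℕ} {s s' : RamState} (h : s.Agree K s') (hK : K' ≤ K) :
    s.Agree K' s' :=
  ⟨fun j hj => h.1 j (by omega), h.2⟩

theorem RamState.Agree.trans {K : ℕ} {s s' s'' : RamState} (h : s.Agree K s')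
    (h' : s'.Agree K s'') : s.Agree K s'' :=
  ⟨fun j hj => (h.1 j hj).trans (h'.1 j hj), h.2.1.trans h'.2.1, h.2.2.trans h'.2.2⟩

namespace RamExp

theorem Below.mono {K K' : ℕ} (hK : K ≤ K') : ∀ {e : RamExp}, e.Below K → e.Below K'
  | var _, h => lt_of_lt_of_le h hK
  | lit _, _ => trivial
  | bin _ _ _, h => ⟨Below.mono hK h.1, Below.mono hK h.2⟩
  | get e, h => Below.mono (e := e) hK h

theorem eval_congr {K : ℕ} {s s' : RamState} (hs : s.Agree K s') :
    ∀ {e : RamExp}, e.Below K → e.eval s = e.eval s'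
  | var _, h => hs.1 _ h
  | lit _, _ => rfl
  | bin _ e f, h => by simp only [eval, eval_congr hs h.1, eval_congr hs h.2]
  | get e, h => by simp only [eval, eval_congr (e := e) hs h, hs.2.1]

theorem fits_congr {B K : ℕ} {s s' : RamState} (hs : s.Agree K s') :
    ∀ {e : RamExp}, e.Below K → (e.Fits B s ↔ e.Fits B s')
  | var _, h => by simp only [Fits, hs.1 _ h]
  | lit _, _ => Iff.rfl
  | bin _ e f, h => by
      simp only [Fits, eval_congr hs h.1, eval_congr hs h.2, fits_congr hs h.1,
        fits_congr hs h.2]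
  | get e, h => by simp only [Fits, fits_congr (e := e) hs h]

/-- Scratch space is used as a stack: the first operand stays in register `k` while the second is
evaluated from `k + 1` on, and code started at `k` never touches a register below `k`. -/
theorem exec_code {B : ℕ} : ∀ (e : RamExp) (k : ℕ) (s : RamState), e.Below k → e.Fits B s →
    ∃ s', RamExec B (e.code k) s s' e.time ∧ s'.Agree k s ∧ s'.reg k = e.eval s
  | var j, k, s, h, hf => by
      have hj : j ≠ k := Nat.ne_of_lt h
      refine ⟨_, RamExec.seq (RamExec.const s k 0 (Nat.zero_le _)) (RamExec.arith _ .add k j k ?_),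
        ⟨fun i hi => ?_, rfl, rfl⟩, ?_⟩
      · simpa [ArithOp.eval, hj, Fits] using hf
      · simp [Function.update_of_ne (Nat.ne_of_lt hi)]
      · simp [ArithOp.eval, eval, hj]
  | lit v, k, s, _, hf => by
      refine ⟨_, RamExec.const s k v hf, ⟨fun i hi => ?_, rfl, rfl⟩, ?_⟩
      · simp [Function.update_of_ne (Nat.ne_of_lt hi)]
      · simp [eval]
  | bin o e f, k, s, h, hf => by
      obtain ⟨s₁, h₁, a₁, v₁⟩ := exec_code e k s h.1 hf.1
      obtain ⟨s₂, h₂, a₂, v₂⟩ := exec_code f (k + 1) s₁ (h.2.mono (by omega))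
        ((fits_congr a₁ h.2).2 hf.2.1)
      rw [eval_congr a₁ h.2] at v₂
      have v₁' : s₂.reg k = e.eval s := (a₂.1 k (by omega)).trans v₁
      refine ⟨_, RamExec.seq h₁ (RamExec.seq h₂ (RamExec.arith _ o k k (k + 1) ?_)),
        ⟨fun i hi => ?_, ?_, ?_⟩, ?_⟩
      · rw [v₁', v₂]; exact hf.2.2
      · simp only [Function.update_of_ne (Nat.ne_of_lt hi)]
        exact (a₂.1 i (by omega)).trans (a₁.1 i hi)
      · exact a₂.2.1.trans a₁.2.1
      · exact a₂.2.2.trans a₁.2.2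
      · simp [v₁', v₂, eval]
  | get e, k, s, h, hf => by
      obtain ⟨s₁, h₁, a₁, v₁⟩ := exec_code e k s h hf
      refine ⟨_, RamExec.seq h₁ (RamExec.load _ k k), ⟨fun i hi => ?_, a₁.2⟩, ?_⟩
      · simp only [Function.update_of_ne (Nat.ne_of_lt hi)]
        exact a₁.1 i hi
      · simp [v₁, eval, a₁.2.1]

end RamExp

/-! ### A time-bounded Hoare logic -/

/-- The number of registers that are used as variables; the others are scratch space. -/
def numVars : ℕ := 32

namespace RamProg

/-- Assign the value of an expression to a variable. -/
def assign (d : ℕ) (e : RamExp) : RamProg :=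
  .seq (e.code numVars) (.seq (.const d 0) (.arith .add d d numVars))

/-- Write the value of an expression to the memory. -/
def write (e f : RamExp) : RamProg :=
  .seq (e.code numVars) (.seq (f.code (numVars + 1)) (.store numVars (numVars + 1)))

/-- Output the value of an expression. -/
def print (e : RamExp) : RamProg := .seq (e.code numVars) (.emit numVars)

end RamProg

/-- From any state that agrees with `σ` on the variables, `p` terminates within `T` steps in a state
that agrees on the variables with a state satisfying `Q`. -/
def Achieves (B : ℕ) (p : RamProg) (T : ℕ) (σ : RamState) (Q : RamState → Prop) : Prop :=
  ∀ s : RamState, s.Agree numVars σ → ∃ s' σ' t, RamExec B p s s' t ∧ t ≤ T ∧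
    s'.Agree numVars σ' ∧ Q σ'

namespace Achieves

variable {B T T' : ℕ} {p q : RamProg} {σ : RamState} {Q Q' : RamState → Prop}

theorem mono (h : Achieves B p T σ Q) (hT : T ≤ T') (hQ : ∀ σ', Q σ' → Q' σ') :
    Achieves B p T' σ Q' := fun s hs => by
  obtain ⟨s', σ', t, h₁, h₂, h₃, h₄⟩ := h s hs
  exact ⟨s', σ', t, h₁, h₂.trans hT, h₃, hQ _ h₄⟩

theorem seq (hp : Achieves B p T σ Q) (hq : ∀ σ', Q σ' → Achieves B q T' σ' Q') :
    Achieves B (.seq p q) (T + T') σ Q' := fun s hs => by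
  obtain ⟨s₁, σ₁, t₁, h₁, l₁, a₁, q₁⟩ := hp s hs
  obtain ⟨s₂, σ₂, t₂, h₂, l₂, a₂, q₂⟩ := hq σ₁ q₁ s₁ a₁
  exact ⟨s₂, σ₂, _, RamExec.seq h₁ h₂, by omega, a₂, q₂⟩

theorem skip (h : Q σ) (hT : 1 ≤ T := by decide) : Achieves B .skip T σ Q := fun s hs =>
  ⟨s, σ, 1, RamExec.skip s, hT, hs, h⟩

/-- The syntactic conditions on registers and running time are default arguments solved by `decide`;
only the semantic bounds and the postcondition remain as goals. -/
theorem assign {d : ℕ} {e : RamExp} (hf : e.Fits B σ) (hv : e.eval σ ≤ B)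
    (hQ : Q { σ with reg := Function.update σ.reg d (e.eval σ) }) (hd : d < numVars := by decide)
    (he : e.Below numVars := by decide) (hT : e.time + 2 ≤ T := by decide) :
    Achieves B (.assign d e) T σ Q := fun s hs => by
  obtain ⟨s₁, h₁, a₁, v₁⟩ := e.exec_code numVars s he ((RamExp.fits_congr hs he).2 hf)
  have hdn : numVars ≠ d := Nat.ne_of_gt hd
  rw [RamExp.eval_congr hs he] at v₁
  refine ⟨_, _, _, RamExec.seq h₁ (RamExec.seq (RamExec.const _ d 0 (Nat.zero_le _))
    (RamExec.arith _ .add d d numVars ?_)), hT, ⟨fun j hj => ?_, ?_, ?_⟩, hQ⟩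
  · simpa [ArithOp.eval, hdn, v₁] using hv
  · by_cases hjd : j = d
    · subst hjd
      simp [ArithOp.eval, hdn, v₁]
    · simp [hjd, a₁.1 j hj, hs.1 j hj]
  · exact a₁.2.1.trans hs.2.1
  · exact a₁.2.2.trans hs.2.2

theorem write {e f : RamExp} (he' : e.Fits B σ) (hf' : f.Fits B σ)
    (hQ : Q { σ with mem := Function.update σ.mem (e.eval σ) (f.eval σ) })
    (he : e.Below numVars := by decide) (hf : f.Below numVars := by decide)
    (hT : e.time + (f.time + 1) ≤ T := by decide) :
    Achieves B (.write e f) T σ Q := fun s hs => by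
  obtain ⟨s₁, h₁, a₁, v₁⟩ := e.exec_code numVars s he ((RamExp.fits_congr hs he).2 he')
  have a₁' := a₁.trans hs
  obtain ⟨s₂, h₂, a₂, v₂⟩ := f.exec_code (numVars + 1) s₁ (hf.mono (Nat.le_succ _))
    ((RamExp.fits_congr a₁' hf).2 hf')
  rw [RamExp.eval_congr a₁' hf] at v₂
  rw [RamExp.eval_congr hs he] at v₁
  have a₂' := (a₂.mono (Nat.le_succ _)).trans a₁'
  refine ⟨_, _, _, RamExec.seq h₁ (RamExec.seq h₂ (RamExec.store _ _ _)), hT,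
    ⟨fun j hj => ?_, ?_, ?_⟩, hQ⟩
  · exact a₂'.1 j hj
  · simp [v₂, a₂.1 numVars (Nat.lt_succ_self _), v₁, a₂'.2.1]
  · exact a₂'.2.2

theorem print {e : RamExp} (hf : e.Fits B σ) (hQ : Q { σ with out := σ.out ++ [e.eval σ] })
    (he : e.Below numVars := by decide) (hT : e.time + 1 ≤ T := by decide) :
    Achieves B (.print e) T σ Q := fun s hs => by
  obtain ⟨s₁, h₁, a₁, v₁⟩ := e.exec_code numVars s he ((RamExp.fits_congr hs he).2 hf)
  rw [RamExp.eval_congr hs he] at v₁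
  have a₁' := a₁.trans hs
  refine ⟨_, { σ with out := σ.out ++ [e.eval σ] }, _, RamExec.seq h₁ (RamExec.emit _ _), hT,
    ⟨a₁'.1, a₁'.2.1, ?_⟩, hQ⟩
  simp [v₁, a₁'.2.2]

theorem ite {a b : ℕ} (hp : σ.reg a < σ.reg b → Achieves B p (T - 1) σ Q)
    (hq : ¬ σ.reg a < σ.reg b → Achieves B q (T - 1) σ Q) (ha : a < numVars := by decide)
    (hb : b < numVars := by decide) (hT : 1 ≤ T := by decide) :
    Achieves B (.ifLt a b p q) T σ Q := fun s hs => by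
  by_cases h : σ.reg a < σ.reg b
  · obtain ⟨s', σ', t, h₁, l₁, r⟩ := hp h s hs
    exact ⟨s', σ', t + 1, RamExec.ifTrue (by rwa [hs.1 a ha, hs.1 b hb]) h₁, by omega, r⟩
  · obtain ⟨s', σ', t, h₁, l₁, r⟩ := hq h s hs
    exact ⟨s', σ', t + 1, RamExec.ifFalse (by rwa [hs.1 a ha, hs.1 b hb]) h₁, by omega, r⟩

/-- Subtracting from the budget `T`, instead of adding up costs, keeps the remaining budget a closed
numeral along a chain of commands whenever `T` is one, so that `decide` can check it. -/
theorem seq_sub (T₁ : ℕ) (hp : Achieves B p T₁ σ Q) (hq : ∀ σ', Q σ' → Achieves B q (T - T₁) σ' Q')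
    (hT : T₁ ≤ T := by decide) : Achieves B (.seq p q) T σ Q' :=
  (seq hp hq).mono (by omega) fun _ h => h

theorem assign_seq {d : ℕ} {e : RamExp} (hf : e.Fits B σ) (hv : e.eval σ ≤ B)
    (hq : Achieves B q (T - (e.time + 2)) { σ with reg := Function.update σ.reg d (e.eval σ) } Q)
    (hd : d < numVars := by decide) (he : e.Below numVars := by decide)
    (hT : e.time + 2 ≤ T := by decide) :
    Achieves B (.seq (.assign d e) q) T σ Q :=
  seq_sub (Q := fun σ' => σ' = { σ with reg := Function.update σ.reg d (e.eval σ) }) _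
    (assign hf hv rfl hd he le_rfl) (fun _ h => h ▸ hq) hT

theorem print_seq {e : RamExp} (hf : e.Fits B σ)
    (hq : Achieves B q (T - (e.time + 1)) { σ with out := σ.out ++ [e.eval σ] } Q)
    (he : e.Below numVars := by decide) (hT : e.time + 1 ≤ T := by decide) :
    Achieves B (.seq (.print e) q) T σ Q :=
  seq_sub (Q := fun σ' => σ' = { σ with out := σ.out ++ [e.eval σ] }) _
    (print hf rfl he le_rfl) (fun _ h => h ▸ hq) hT

/-- The index `m` of the invariant is a variant: it drops strictly in each iteration, so there are
at most `m` iterations of `T + 1` steps, plus the final failing test. -/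
theorem loop {a b : ℕ} (ha : a < numVars) (hb : b < numVars) (I : ℕ → RamState → Prop)
    (hp : ∀ m σ, I m σ → σ.reg a < σ.reg b →
      0 < m ∧ Achieves B p T σ (fun σ' => ∃ m' < m, I m' σ')) (m : ℕ) :
    ∀ σ, I m σ → Achieves B (.whileLt a b p) ((T + 1) * m + 1) σ
      (fun σ' => (∃ m' ≤ m, I m' σ') ∧ ¬ σ'.reg a < σ'.reg b) := by
  induction m using Nat.strong_induction_on with
  | _ m ih =>
    intro σ hI s hs
    by_cases h : σ.reg a < σ.reg b
    · obtain ⟨hm, hw⟩ := hp m σ hI h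
      obtain ⟨s₁, σ₁, t₁, h₁, l₁, a₁, m', hm', hI'⟩ := hw s hs
      obtain ⟨s₂, σ₂, t₂, h₂, l₂, a₂, ⟨m'', hm'', hI''⟩, hn⟩ := ih m' hm' σ₁ hI' s₁ a₁
      refine ⟨s₂, σ₂, _, RamExec.whileTrue (by rwa [hs.1 a ha, hs.1 b hb]) h₁ h₂, ?_, a₂,
        ⟨m'', by omega, hI''⟩, hn⟩
      have : (T + 1) * (m' + 1) ≤ (T + 1) * m := Nat.mul_le_mul_left _ hm'
      rw [Nat.mul_add] at this
      omega
    · exact ⟨s, σ, 1, RamExec.whileFalse (by rwa [hs.1 a ha, hs.1 b hb]), by omega, hs,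
        ⟨m, le_rfl, hI⟩, h⟩

end Achieves

/-! ### The dynamic program -/

/-- The `i` leftmost cells of row `h`. -/
def rowCells (i h : ℕ) : List (ℕ × ℕ) := (List.range i).map fun x => (x, h)

/-- `Fill n i g a b u v L c`: the Young diagram whose boundary passes through the corner
`(i, n - g)` is completed by the cells `L` in the rows from `n - g` on, at cost `c`. Here `a` and `b`
are the numbers of cells in the columns `i, i + 2, …` and `i + 1, i + 3, …`, and `u` and `v` are the
numbers of cells in the rows `n - g, n - g + 2, …` and `n - g + 1, n - g + 3, …`. -/
inductive Fill (n : ℕ) : ℕ → ℕ → ℕ → ℕ → ℕ → ℕ → List (ℕ × ℕ) → ℕ → Prop where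
  | done (g a b : ℕ) : Fill n 0 g a b 0 0 [] 0
  -- The closed column `i` has height `n - g` and joins the parity class counted by `b`; `a * (n -
  -- a)` is the cost of column cut `i + 1`.
  | col {i g a b u v : ℕ} {L : List (ℕ × ℕ)} {c : ℕ} (h : b + (n - g) ≤ n)
      (hL : Fill n i g (b + (n - g)) a u v L c) : Fill n (i + 1) g a b u v L (c + a * (n - a))
  -- The closed row `n - (g + 1)` has length `i + 1`, which is paid from `u`; `v * (n - v)` is the
  -- cost of row cut `n - g`.
  | row {i g a b u v : ℕ} {L : List (ℕ × ℕ)} {c : ℕ} (h : i + 1 ≤ u)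
      (hL : Fill n (i + 1) g a b v (u - (i + 1)) L c) :
      Fill n (i + 1) (g + 1) a b u v (rowCells (i + 1) (n - (g + 1)) ++ L) (c + v * (n - v))

/-- `M` minus the least cost of completing the diagram, or `0` if this is impossible. -/
def bestFill (n M : ℕ) : ℕ → ℕ → ℕ → ℕ → ℕ → ℕ → ℕ
  | 0, _, _, _, u, v => if 0 < u + v then 0 else M
  | i + 1, g, a, b, u, v =>
    max (if b + (n - g) < n + 1 then bestFill n M i g (b + (n - g)) a u v - a * (n - a) else 0)
      (match g with
      | 0 => 0
      | g + 1 => if u < i + 1 then 0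
          else bestFill n M (i + 1) g a b v (u - (i + 1)) - v * (n - v))
termination_by i g => (i, g)

/-- The value of `bestFill` if the next step closes a column. -/
def colOption (n M i g a b u v : ℕ) : ℕ :=
  if 0 < i then
    if b + (n - g) < n + 1 then bestFill n M (i - 1) g (b + (n - g)) a u v - a * (n - a) else 0
  else if 0 < u + v then 0 else M

/-- The value of `bestFill` if the next step closes a row. -/
def rowOption (n M i g a b u v : ℕ) : ℕ :=
  if 0 < i ∧ 0 < g ∧ i ≤ u then bestFill n M i (g - 1) a b v (u - i) - v * (n - v) else 0

/-- Turns the recursion by patterns into the two case distinctions that the machine actually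
evaluates. -/
theorem bestFill_eq_max (n M i g a b u v : ℕ) :
    bestFill n M i g a b u v = max (colOption n M i g a b u v) (rowOption n M i g a b u v) := by
  rcases i with _ | i
  · simp [bestFill, colOption, rowOption]
  · rcases g with _ | g
    · rw [bestFill]
      simp [colOption, rowOption]
    · rw [bestFill]
      simp only [colOption, rowOption, Nat.succ_pos, if_true, true_and, Nat.add_sub_cancel]
      congr 1
      by_cases h : u < i + 1
      · rw [if_pos h, if_neg (by omega)]
      · rw [if_neg h, if_pos (by omega)]

theorem bestFill_le (n M : ℕ) (i g a b u v : ℕ) : bestFill n M i g a b u v ≤ M := by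
  induction hk : i + g using Nat.strong_induction_on generalizing i g a b u v with
  | _ k ih =>
    rw [bestFill_eq_max]
    refine max_le ?_ ?_
    · unfold colOption
      split_ifs with h₁
      · exact (Nat.sub_le _ _).trans (ih (i - 1 + g) (by omega) _ _ _ _ _ _ rfl)
      all_goals omega
    · unfold rowOption
      split_ifs with h₁
      · exact (Nat.sub_le _ _).trans (ih (i + (g - 1)) (by omega) _ _ _ _ _ _ rfl)
      · omega

/-- The optimality half: each step of a filling is one of the two options, and truncated subtraction
only makes the inequality weaker. -/
theorem Fill.le_bestFill {n i g a b u v c : ℕ} {L : List (ℕ × ℕ)} (M : ℕ)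
    (h : Fill n i g a b u v L c) : M ≤ bestFill n M i g a b u v + c := by
  induction h with
  | done g a b => simp [bestFill]
  | @col i g a b u v L c h _ ih =>
    have h₁ : colOption n M (i + 1) g a b u v ≤ _ :=
      (le_max_left _ _).trans_eq (bestFill_eq_max n M (i + 1) g a b u v).symm
    rw [colOption, if_pos (Nat.succ_pos i), if_pos (by omega), Nat.add_sub_cancel] at h₁
    omega
  | @row i g a b u v L c h _ ih =>
    have h₁ : rowOption n M (i + 1) (g + 1) a b u v ≤ _ :=
      (le_max_right _ _).trans_eq (bestFill_eq_max n M (i + 1) (g + 1) a b u v).symm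
    rw [rowOption, if_pos (by omega), Nat.add_sub_cancel] at h₁
    omega

/-- There are at most `i + g` steps, each of cost at most `n ^ 2`. Hence a polynomial `M` exceeds
every cost, and the value `0` can stand for infeasibility. -/
theorem Fill.cost_le {n i g a b u v c : ℕ} {L : List (ℕ × ℕ)} (h : Fill n i g a b u v L c) :
    c ≤ (i + g) * n ^ 2 := by
  have hb : ∀ m, m * (n - m) ≤ n ^ 2 := fun m => by
    rcases le_total m n with hm | hm
    · rw [pow_two]; exact Nat.mul_le_mul hm (Nat.sub_le _ _)
    · simp [Nat.sub_eq_zero_of_le hm]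
  induction h with
  | done => simp
  | @col i g a b u v L c h _ ih => have := hb a; nlinarith
  | @row i g a b u v L c h _ ih => have := hb v; nlinarith

/-- Following the better option, from a feasible corner. -/
theorem bestFill_col {n M i g a b u v : ℕ} (hi : 0 < i) (hpos : 0 < bestFill n M i g a b u v)
    (hle : rowOption n M i g a b u v ≤ colOption n M i g a b u v) :
    b + (n - g) ≤ n ∧
      bestFill n M (i - 1) g (b + (n - g)) a u v = bestFill n M i g a b u v + a * (n - a) := by
  rw [bestFill_eq_max n M i g a b u v, max_eq_left hle] at hpos ⊢
  rw [colOption, if_pos hi] at hpos ⊢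
  -- A positive difference was not cut off, so the subtraction can be undone.
  split_ifs at hpos ⊢ with h
  · omega
  · omega

/-- Exceeding the other option strictly already makes the row option positive, hence feasible and
not cut off. Ties go to the column. -/
theorem bestFill_row {n M i g a b u v : ℕ}
    (hlt : colOption n M i g a b u v < rowOption n M i g a b u v) :
    0 < i ∧ 0 < g ∧ i ≤ u ∧
      bestFill n M i (g - 1) a b v (u - i) = bestFill n M i g a b u v + v * (n - v) := by
  rw [bestFill_eq_max n M i g a b u v, max_eq_right hlt.le]
  rw [rowOption] at hlt ⊢
  split_ifs at hlt ⊢ with h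
  · omega
  · omega

theorem bestFill_zero {n M g a b u v : ℕ} (hpos : 0 < bestFill n M 0 g a b u v) :
    u = 0 ∧ v = 0 ∧ bestFill n M 0 g a b u v = M := by
  rw [bestFill] at hpos ⊢
  split_ifs at hpos ⊢ with h
  · omega
  · exact ⟨by omega, by omega, rfl⟩

/-! ### The program -/

/-- The address of the table entry for a corner, with entries `0, …, N - 1` in each coordinate. -/
def tableIndex (N i g a b u v : ℕ) : ℕ := ((((i * N + g) * N + a) * N + b) * N + u) * N + v

theorem mul_add_lt_mul {N q r q' : ℕ} (hq : q < q') (hr : r < N) : q * N + r < q' * N := by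
  have : (q + 1) * N ≤ q' * N := Nat.mul_le_mul_right _ hq
  rw [Nat.add_mul] at this
  omega

theorem tableIndex_lt {n i g a b u v : ℕ} (hi : i ≤ n) (hg : g ≤ n) (ha : a ≤ n) (hb : b ≤ n)
    (hu : u ≤ n) (hv : v ≤ n) : tableIndex (n + 1) i g a b u v < (n + 1) ^ 6 := by
  have : (n + 1) ^ 6 = (n + 1) * (n + 1) * (n + 1) * (n + 1) * (n + 1) * (n + 1) := by ring
  rw [this]
  iterate 5 refine mul_add_lt_mul ?_ (by omega)
  omega

theorem mul_add_lt_mul_add {N q r q' r' : ℕ} (hq : q < q') (hr : r < N) :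
    q * N + r < q' * N + r' :=
  (mul_add_lt_mul hq hr).trans_le (Nat.le_add_right _ _)

/-- Closing a column lowers the leading digit `i`; closing a row keeps `i` and lowers the second
digit `g`. A single sweep through increasing addresses therefore finds all needed entries already
computed. -/
theorem tableIndex_lt_of_col {N i g a b u v a' b' u' v' : ℕ} (hi : 0 < i) (hg : g < N)
    (ha' : a' < N) (hb' : b' < N) (hu' : u' < N) (hv' : v' < N) :
    tableIndex N (i - 1) g a' b' u' v' < tableIndex N i g a b u v := by
  unfold tableIndex
  iterate 5 refine mul_add_lt_mul_add ?_ (by assumption)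
  omega

theorem tableIndex_lt_of_row {N i g a b u v a' b' u' v' : ℕ} (hg : 0 < g)
    (ha' : a' < N) (hb' : b' < N) (hu' : u' < N) (hv' : v' < N) :
    tableIndex N i (g - 1) a' b' u' v' < tableIndex N i g a b u v := by
  unfold tableIndex
  iterate 4 refine mul_add_lt_mul_add ?_ (by assumption)
  omega

open RamExp in
/-- The expression for `tableIndex`. Register `1` holds the number of entries per coordinate. -/
def indexExp (i g a b u v : RamExp) : RamExp :=
  ((((i * var 1 + g) * var 1 + a) * var 1 + b) * var 1 + u) * var 1 + v

theorem eval_indexExp (σ : RamState) (i g a b u v : RamExp) :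
    (indexExp i g a b u v).eval σ = tableIndex (σ.reg 1) (i.eval σ) (g.eval σ) (a.eval σ)
      (b.eval σ) (u.eval σ) (v.eval σ) := rfl

/-- In Horner's scheme no intermediate result exceeds the final one, so the bound on the index
bounds the whole evaluation. -/
theorem fits_indexExp {B n : ℕ} {σ : RamState} (hB : (n + 1) ^ 6 ≤ B) (hσ : σ.reg 1 = n + 1)
    {i g a b u v : RamExp} (hi : i.Fits B σ ∧ i.eval σ ≤ n) (hg : g.Fits B σ ∧ g.eval σ ≤ n)
    (ha : a.Fits B σ ∧ a.eval σ ≤ n) (hb : b.Fits B σ ∧ b.eval σ ≤ n)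
    (hu : u.Fits B σ ∧ u.eval σ ≤ n) (hv : v.Fits B σ ∧ v.eval σ ≤ n) :
    (indexExp i g a b u v).Fits B σ := by
  have h := (tableIndex_lt hi.2 hg.2 ha.2 hb.2 hu.2 hv.2).le.trans hB
  have hN : n + 1 ≤ B := (Nat.le_self_pow (by norm_num) _).trans hB
  unfold tableIndex at h
  have key : ∀ q r : ℕ, q * (n + 1) + r ≤ B → q * (n + 1) ≤ B ∧ q ≤ B := fun q r h =>
    
    have h' := Nat.le_mul_of_pos_right q (Nat.succ_pos n)
    ⟨by omega, h'.trans (by rw [Nat.succ_eq_add_one]; omega)⟩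
  have h₁ := key _ _ h
  have h₂ := key _ _ h₁.2
  have h₃ := key _ _ h₂.2
  have h₄ := key _ _ h₃.2
  have h₅ := key _ _ h₄.2
  simp only [indexExp, RamExp.fits_add, RamExp.fits_mul, RamExp.fits_var, RamExp.eval_add,
    RamExp.eval_mul, RamExp.eval_var, hσ]
  tauto

section program

open RamExp RamProg

/-! The registers: `0` holds `n`, `1` holds `n + 1`, `2` holds `(n + 1) ^ 6`, `3` is the current
address, `4` to `9` hold a corner, `10` and `11` its two options, `13` and `14` the best value and
its start, `15` and `18` count loops, `16` holds `0`, and `12` and `17` are temporary. -/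

/-- Compute the two options at the current corner. -/
def optionsProg : RamProg :=
  .seq (assign 10 (lit 0)) <| .seq (assign 11 (lit 0)) <|
  .ifLt 16 4
    (.seq (assign 17 (var 0 - var 5)) <| .seq (assign 12 (var 7 + var 17)) <|
      .seq
        (.ifLt 12 1
          (assign 10 (get (indexExp (var 4 - lit 1) (var 5) (var 12) (var 6) (var 8) (var 9)) -
            var 6 * (var 0 - var 6)))
          .skip)
        (.ifLt 16 5
          (.ifLt 8 4 .skip
            (assign 11 (get (indexExp (var 4) (var 5 - lit 1) (var 6) (var 7) (var 9)
              (var 8 - var 4)) - var 9 * (var 0 - var 9))))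
          .skip))
    (.seq (assign 12 (var 8 + var 9)) (.ifLt 16 12 .skip (assign 10 (var 2))))

/-- Split the address into its digits. -/
def decodeProg : RamProg :=
  .seq (assign 9 (var 3 - var 3 / var 1 * var 1)) <| .seq (assign 12 (var 3 / var 1)) <|
  .seq (assign 8 (var 12 - var 12 / var 1 * var 1)) <| .seq (assign 12 (var 12 / var 1)) <|
  .seq (assign 7 (var 12 - var 12 / var 1 * var 1)) <| .seq (assign 12 (var 12 / var 1)) <|
  .seq (assign 6 (var 12 - var 12 / var 1 * var 1)) <| .seq (assign 12 (var 12 / var 1)) <|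
  .seq (assign 5 (var 12 - var 12 / var 1 * var 1)) <| assign 4 (var 12 / var 1)

/-- Compute one table entry. -/
def entryProg : RamProg :=
  .seq decodeProg <| .seq optionsProg <|
  .seq (.ifLt 10 11 (write (var 3) (var 11)) (write (var 3) (var 10))) <|
  assign 3 (var 3 + lit 1)

/-- Compute the table. -/
def tableProg : RamProg :=
  .seq (assign 1 (var 0 + lit 1)) <|
  .seq (assign 2 (var 1 * var 1 * var 1 * var 1 * var 1 * var 1)) <| .whileLt 3 2 entryProg

/-- Find the best split of the cells into even and odd rows. -/
def searchProg : RamProg :=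
  .whileLt 15 1 <|
    .seq (assign 12 (get (indexExp (var 0) (var 0) (lit 0) (lit 0) (var 15) (var 0 - var 15)))) <|
    .seq (.ifLt 13 12 (.seq (assign 13 (var 12)) (assign 14 (var 15))) .skip) <|
    assign 15 (var 15 + lit 1)

/-- The coordinate at which the `k`-th row or column is placed. -/
def place (n k : ℕ) : ℕ := n + k % 2 * k - k / 2

/-- The expression for `place`. -/
def placeExp (k : ℕ) : RamExp :=
  var 0 + (var k - var k / lit 2 * lit 2) * var k - var k / lit 2

/-- The contribution of a list of cells to the output. -/
def printed (n : ℕ) (L : List (ℕ × ℕ)) : List ℕ :=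
  (L.map fun p => (place n p.1, place n p.2)).flatMap fun p => [p.1, p.2]

/-- Output the cells of a row. -/
def printRowProg : RamProg :=
  .whileLt 18 4 <|
    .seq (print (placeExp 18)) <| .seq (print (placeExp 17)) <| assign 18 (var 18 + lit 1)

/-- Close a row. -/
def rowProg : RamProg :=
  .seq (assign 17 (var 0 - var 5)) <| .seq (assign 18 (lit 0)) <| .seq printRowProg <|
  .seq (assign 5 (var 5 - lit 1)) <| .seq (assign 12 (var 8 - var 4)) <|
  .seq (assign 8 (var 9)) <| assign 9 (var 12)

/-- Close a column. -/
def colProg : RamProg :=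
  .seq (assign 12 (var 7 + (var 0 - var 5))) <| .seq (assign 7 (var 6)) <|
  .seq (assign 6 (var 12)) <| assign 4 (var 4 - lit 1)

/-- Follow the best options and output the cells. -/
def traceProg : RamProg :=
  .seq (assign 4 (var 0)) <| .seq (assign 5 (var 0)) <| .seq (assign 6 (lit 0)) <|
  .seq (assign 7 (lit 0)) <| .seq (assign 8 (var 14)) <| .seq (assign 9 (var 0 - var 14)) <|
  .whileLt 16 4 (.seq optionsProg (.ifLt 10 11 rowProg colProg))

/-- Output an optimal town. -/
def townProg : RamProg := .seq tableProg (.seq searchProg traceProg)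

/-! ### Specifications of the subprograms -/

/-- The registers that hold the parameters. -/
structure Params (n : ℕ) (σ : RamState) : Prop where
  size : σ.reg 0 = n
  base : σ.reg 1 = n + 1
  bound : σ.reg 2 = (n + 1) ^ 6
  zero : σ.reg 16 = 0

/-- The current corner. -/
structure Corner (n i g a b u v : ℕ) (σ : RamState) : Prop where
  reg_i : σ.reg 4 = i
  reg_g : σ.reg 5 = g
  reg_a : σ.reg 6 = a
  reg_b : σ.reg 7 = b
  reg_u : σ.reg 8 = u
  reg_v : σ.reg 9 = v
  le_i : i ≤ n
  le_g : g ≤ n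
  le_a : a ≤ n
  le_b : b ≤ n
  le_u : u ≤ n
  le_v : v ≤ n

/-- The states have the same memory and output, and the same registers apart from a list. -/
def SameBut (l : List ℕ) (σ σ' : RamState) : Prop :=
  (∀ j, j ∉ l → σ'.reg j = σ.reg j) ∧ σ'.mem = σ.mem ∧ σ'.out = σ.out

theorem Params.congr {n : ℕ} {σ σ' : RamState} (h : Params n σ) (h0 : σ'.reg 0 = σ.reg 0)
    (h1 : σ'.reg 1 = σ.reg 1) (h2 : σ'.reg 2 = σ.reg 2) (h16 : σ'.reg 16 = σ.reg 16) :
    Params n σ' :=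
  ⟨h0.trans h.size, h1.trans h.base, h2.trans h.bound, h16.trans h.zero⟩

/-- Room for all numbers that occur. -/
structure Room (n B : ℕ) : Prop where
  pow : (n + 1) ^ 6 ≤ B
  double : 2 * n + 2 ≤ B
  mul : ∀ a ≤ n, ∀ b ≤ n, a * b ≤ B

/-- Only the entries of the two successors are assumed, so that this serves both a partially filled
table and the traceback. -/
theorem achieves_optionsProg {n B i g a b u v : ℕ} {σ : RamState} (hB : Room n B)
    (hp : Params n σ) (hc : Corner n i g a b u v σ)
    (hcol : 0 < i → b + (n - g) ≤ n →
      σ.mem (tableIndex (n + 1) (i - 1) g (b + (n - g)) a u v) =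
        bestFill n ((n + 1) ^ 6) (i - 1) g (b + (n - g)) a u v)
    (hrow : 0 < i → 0 < g → i ≤ u →
      σ.mem (tableIndex (n + 1) i (g - 1) a b v (u - i)) =
        bestFill n ((n + 1) ^ 6) i (g - 1) a b v (u - i)) :
    Achieves B optionsProg 300 σ (fun σ' => SameBut [10, 11, 12, 17] σ σ' ∧
      σ'.reg 10 = colOption n ((n + 1) ^ 6) i g a b u v ∧
      σ'.reg 11 = rowOption n ((n + 1) ^ 6) i g a b u v) := by
  obtain ⟨h0, h1, h2, h16⟩ := hp
  obtain ⟨h4, h5, h6, h7, h8, h9, hi, hg, ha, hb, hu, hv⟩ := hc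
  obtain ⟨hB1, hB2, hB3⟩ := hB
  have hle := fun i g a b u v => (bestFill_le n ((n + 1) ^ 6) i g a b u v).trans hB1
  have hSB : ∀ j w (ρ : RamState), j ∈ [10, 11, 12, 17] → SameBut [10, 11, 12, 17] σ ρ →
      SameBut [10, 11, 12, 17] σ { ρ with reg := Function.update ρ.reg j w } := by
    rintro j w ρ hj ⟨hr, hm, ho⟩
    refine ⟨fun k hk => ?_, hm, ho⟩
    rw [← hr k hk]
    exact Function.update_of_ne (by rintro rfl; exact hk hj) _ _
  have hrefl : SameBut [10, 11, 12, 17] σ σ := ⟨fun _ _ => rfl, rfl, rfl⟩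
  refine Achieves.assign_seq (by simp) (by simp) <| Achieves.assign_seq (by simp) (by simp) <|
    Achieves.ite (fun hi0 => ?_) (fun hi0 => ?_)
  · simp [h16, h4] at hi0
    refine Achieves.assign_seq (by simp [h0, h5]; omega) (by simp [h0, h5]; omega) <|
      Achieves.assign_seq (by simp [h0, h5, h7]; omega) (by simp [h0, h5, h7]; omega) <|
      Achieves.seq_sub (Q := fun σ' => SameBut [10, 11, 12, 17] σ σ' ∧
      σ'.reg 10 = colOption n ((n + 1) ^ 6) i g a b u v ∧ σ'.reg 11 = 0) 120
        (Achieves.ite (fun hn => ?_) (fun hn => ?_)) ?_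
    · simp [h0, h5, h7, h1] at hn
      have hval := hcol hi0 (by omega)
      have hp := hB3 a ha (n - a) (by omega)
      have := hle (i - 1) g (b + (n - g)) a u v
      refine Achieves.assign ⟨fits_indexExp (n := n) hB1 ?_ ?_ ?_ ?_ ?_ ?_ ?_, ?_, ?_⟩ ?_
        ⟨hSB _ _ _ (by simp) (hSB _ _ _ (by simp) (hSB _ _ _ (by simp) (hSB _ _ _ (by simp)
          (hSB _ _ _ (by simp) hrefl)))), ?_, ?_⟩
      all_goals simp [h0, h1, h4, h5, h6, h7, h8, h9, eval_indexExp, hval, colOption, ArithOp.eval]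
      all_goals grind
    · simp [h0, h5, h7, h1] at hn
      refine Achieves.skip ⟨hSB _ _ _ (by simp) (hSB _ _ _ (by simp) (hSB _ _ _ (by simp)
        (hSB _ _ _ (by simp) hrefl))), ?_, ?_⟩
      · simp [colOption, hi0, hn]
      · simp
    · rintro τ ⟨hτ, hc, hr⟩
      have g0 := (hτ.1 0 (by simp)).trans h0
      have g1 := (hτ.1 1 (by simp)).trans h1
      have g4 := (hτ.1 4 (by simp)).trans h4
      have g5 := (hτ.1 5 (by simp)).trans h5
      have g6 := (hτ.1 6 (by simp)).trans h6
      have g7 := (hτ.1 7 (by simp)).trans h7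
      have g8 := (hτ.1 8 (by simp)).trans h8
      have g9 := (hτ.1 9 (by simp)).trans h9
      have g16 := (hτ.1 16 (by simp)).trans h16
      refine Achieves.ite (fun hg0 => Achieves.ite (fun hu0 => ?_) (fun hu0 => ?_)) (fun hg0 => ?_)
      · rw [g8, g4] at hu0
        exact Achieves.skip ⟨hτ, hc, by rw [hr, rowOption, if_neg (by omega)]⟩
      · rw [g8, g4] at hu0
        rw [g16, g5] at hg0
        have hval := hrow hi0 hg0 (by omega)
        rw [← hτ.2.1] at hval
        have hp := hB3 v hv (n - v) (by omega)
        have := hle i (g - 1) a b v (u - i)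
        refine Achieves.assign ⟨fits_indexExp (n := n) hB1 ?_ ?_ ?_ ?_ ?_ ?_ ?_, ?_, ?_⟩ ?_
          ⟨hSB _ _ _ (by simp) hτ, ?_, ?_⟩
        all_goals
          simp [g0, g1, g4, g5, g6, g7, g8, g9, eval_indexExp, hval, rowOption, ArithOp.eval]
        all_goals grind
      · rw [g16, g5] at hg0
        exact Achieves.skip ⟨hτ, hc, by rw [hr, rowOption, if_neg (by omega)]⟩
  · simp [h16, h4] at hi0
    refine Achieves.assign_seq (by simp [h8, h9]; omega) (by simp [h8, h9]; omega) <|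
      Achieves.ite (fun hn => ?_) (fun hn => ?_)
    · simp [h16, h8, h9] at hn
      refine Achieves.skip ⟨hSB _ _ _ (by simp) (hSB _ _ _ (by simp) (hSB _ _ _ (by simp)
        hrefl)), ?_, ?_⟩
      · simp [colOption, hi0, hn]
      · simp [rowOption, hi0]
    · simp [h16, h8, h9] at hn
      refine Achieves.assign ?_ ?_ ⟨hSB _ _ _ (by simp) (hSB _ _ _ (by simp) (hSB _ _ _ (by simp)
        (hSB _ _ _ (by simp) hrefl))), ?_, ?_⟩
      · simp [h2, hB1]
      · simp [h2, hB1]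
      · simp [colOption, hi0, hn, h2]
      · simp [rowOption, hi0]

theorem mul_add_inj_of_lt {N q r q' r' : ℕ} (hr : r < N) (hr' : r' < N)
    (h : q * N + r = q' * N + r') : q = q' ∧ r = r' := by
  rcases lt_trichotomy q q' with hq | hq | hq
  · exact absurd h (mul_add_lt_mul_add hq hr).ne
  · subst hq; exact ⟨rfl, by omega⟩
  · exact absurd h.symm (mul_add_lt_mul_add hq hr').ne

/-- Uniqueness of digits in base `N`: a table write affects the entry of one corner only. -/
theorem tableIndex_inj {N i g a b u v i' g' a' b' u' v' : ℕ} (hg : g < N) (ha : a < N) (hb : b < N)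
    (hu : u < N) (hv : v < N) (hg' : g' < N) (ha' : a' < N) (hb' : b' < N) (hu' : u' < N)
    (hv' : v' < N) (h : tableIndex N i g a b u v = tableIndex N i' g' a' b' u' v') :
    i = i' ∧ g = g' ∧ a = a' ∧ b = b' ∧ u = u' ∧ v = v' := by
  obtain ⟨h, h₁⟩ := mul_add_inj_of_lt hv hv' h
  obtain ⟨h, h₂⟩ := mul_add_inj_of_lt hu hu' h
  obtain ⟨h, h₃⟩ := mul_add_inj_of_lt hb hb' h
  obtain ⟨h, h₄⟩ := mul_add_inj_of_lt ha ha' h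
  obtain ⟨h, h₅⟩ := mul_add_inj_of_lt hg hg' h
  exact ⟨h, h₅, h₄, h₃, h₂, h₁⟩

/-- The table entries before the address `x` have been computed. -/
def TableUpTo (n x : ℕ) (σ : RamState) : Prop :=
  ∀ i ≤ n, ∀ g ≤ n, ∀ a ≤ n, ∀ b ≤ n, ∀ u ≤ n, ∀ v ≤ n, tableIndex (n + 1) i g a b u v < x →
    σ.mem (tableIndex (n + 1) i g a b u v) = bestFill n ((n + 1) ^ 6) i g a b u v

theorem achieves_decodeProg {n B x : ℕ} {σ : RamState} (hB : Room n B) (hp : Params n σ)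
    (h3 : σ.reg 3 = x) (hx : x < (n + 1) ^ 6) :
    Achieves B decodeProg 200 σ (fun σ' => ∃ i g a b u v, Corner n i g a b u v σ' ∧
      tableIndex (n + 1) i g a b u v = x ∧ SameBut [4, 5, 6, 7, 8, 9, 12] σ σ') := by
  obtain ⟨h0, h1, h2, h16⟩ := hp
  have hxB : x ≤ B := hx.le.trans hB.pow
  have hN : n + 1 ≤ B := by have := hB.double; omega
  -- Remainders must be computed from division, multiplication and subtraction.
  have hmod : ∀ t, t - t / (n + 1) * (n + 1) = t % (n + 1) := fun t => by
    rw [Nat.mod_eq_sub_mul_div, Nat.mul_comm]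
  have hdiv : ∀ t, t ≤ x → t / (n + 1) ≤ x := fun t h => (Nat.div_le_self _ _).trans h
  have key : ∀ t, t ≤ x → t / (n + 1) ≤ B ∧ t / (n + 1) * (n + 1) ≤ B ∧ t ≤ B := fun t h =>
    ⟨(hdiv t h).trans hxB, ((Nat.div_mul_le_self _ _).trans h).trans hxB, h.trans hxB⟩
  have hle : ∀ t, t % (n + 1) ≤ n := fun t => Nat.lt_succ_iff.1 (Nat.mod_lt _ (Nat.succ_pos n))
  have hleB : ∀ t, t % (n + 1) ≤ B := fun t => (hle t).trans (by omega)
  have k₀ := key x le_rfl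
  have k₁ := key _ (hdiv x le_rfl)
  have k₂ := key _ (hdiv _ (hdiv x le_rfl))
  have k₃ := key _ (hdiv _ (hdiv _ (hdiv x le_rfl)))
  have k₄ := key _ (hdiv _ (hdiv _ (hdiv _ (hdiv x le_rfl))))
  refine Achieves.assign_seq ?_ ?_ <| Achieves.assign_seq ?_ ?_ <| Achieves.assign_seq ?_ ?_ <|
    Achieves.assign_seq ?_ ?_ <| Achieves.assign_seq ?_ ?_ <| Achieves.assign_seq ?_ ?_ <|
    Achieves.assign_seq ?_ ?_ <| Achieves.assign_seq ?_ ?_ <| Achieves.assign_seq ?_ ?_ <|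
    Achieves.assign ?_ ?_ ⟨x / (n + 1) / (n + 1) / (n + 1) / (n + 1) / (n + 1),
      x / (n + 1) / (n + 1) / (n + 1) / (n + 1) % (n + 1),
      x / (n + 1) / (n + 1) / (n + 1) % (n + 1), x / (n + 1) / (n + 1) % (n + 1),
      x / (n + 1) % (n + 1), x % (n + 1), ?_, ?_, ?_⟩
  case refine_21 =>
    constructor
    case le_i =>
      -- The leading digit is not reduced modulo `n + 1`; its bound comes from the size of the
      -- address.
      have : x < (n + 1) * (n + 1) * (n + 1) * (n + 1) * (n + 1) * (n + 1) :=
        hx.trans_eq (by ring)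
      refine Nat.lt_succ_iff.1 ?_
      iterate 5 rw [Nat.div_lt_iff_lt_mul (Nat.succ_pos n)]
      exact this
    all_goals first | exact hle _ | simp [h1, h3, hmod]
  case refine_22 =>
    simp only [tableIndex, Nat.div_add_mod']
  case refine_23 =>
    refine ⟨fun j hj => ?_, rfl, rfl⟩
    simp only [List.mem_cons, List.not_mem_nil, or_false, not_or] at hj
    simp [hj]
  all_goals simp [h1, h3, hmod, hN, hleB, k₀, k₁, k₂, k₃, k₄]

theorem achieves_entryProg {n B x : ℕ} {σ : RamState} (hB : Room n B) (hp : Params n σ)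
    (h3 : σ.reg 3 = x) (hx : x < (n + 1) ^ 6) (ht : TableUpTo n x σ) :
    Achieves B entryProg 600 σ (fun σ' => TableUpTo n (x + 1) σ' ∧ σ'.reg 3 = x + 1 ∧
      (∀ j ∉ [3, 4, 5, 6, 7, 8, 9, 10, 11, 12, 17], σ'.reg j = σ.reg j) ∧ σ'.out = σ.out) := by
  refine Achieves.seq_sub 200 (achieves_decodeProg hB hp h3 hx) ?_
  rintro τ ⟨i, g, a, b, u, v, hc, hidx, hr, hm, ho⟩
  have hpτ : Params n τ := hp.congr (hr 0 (by simp)) (hr 1 (by simp)) (hr 2 (by simp))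
    (hr 16 (by simp))
  obtain ⟨-, -, -, -, -, -, hi, hg, ha, hb, hu, hv⟩ := id hc
  refine Achieves.seq_sub 300 (achieves_optionsProg hB hpτ hc ?_ ?_) ?_
  · intro hi0 hbn
    rw [hm]
    refine ht _ (by omega) _ hg _ hbn _ ha _ hu _ hv ?_
    rw [← hidx]
    exact tableIndex_lt_of_col hi0 (by omega) (by omega) (by omega) (by omega) (by omega)
  · intro hi0 hg0 hiu
    rw [hm]
    refine ht _ hi _ (by omega) _ ha _ hb _ hv _ (by omega) ?_
    rw [← hidx]
    exact tableIndex_lt_of_row hg0 (by omega) (by omega) (by omega) (by omega)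
  rintro ρ ⟨⟨hr', hm', ho'⟩, hcol, hrow⟩
  have hle := (bestFill_le n ((n + 1) ^ 6) i g a b u v).trans hB.pow
  have hxB : x + 1 ≤ B := Nat.succ_le_of_lt (hx.trans_le hB.pow)
  have h3ρ : ρ.reg 3 = x := by rw [hr' 3 (by simp), hr 3 (by simp), h3]
  have hmax := bestFill_eq_max n ((n + 1) ^ 6) i g a b u v
  refine Achieves.seq_sub (Q := fun ω => ω = { ρ with
      mem := Function.update ρ.mem x (bestFill n ((n + 1) ^ 6) i g a b u v) }) 20
    (Achieves.ite (fun h => ?_) (fun h => ?_)) ?_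
  · rw [hcol, hrow] at h
    rw [max_eq_right h.le] at hmax
    refine Achieves.write ?_ ?_ ?_
    · simp [h3ρ]; omega
    · simp [hrow]; omega
    · simp [h3ρ, hrow, hmax]
  · rw [hcol, hrow] at h
    rw [max_eq_left (not_lt.1 h)] at hmax
    refine Achieves.write ?_ ?_ ?_
    · simp [h3ρ]; omega
    · simp [hcol]; omega
    · simp [h3ρ, hcol, hmax]
  rintro _ rfl
  refine Achieves.assign ?_ ?_ ⟨?_, ?_, ?_, ?_⟩
  · simp [h3ρ]; omega
  · simp [h3ρ]; omega
  · intro i' hi' g' hg' a' ha' b' hb' u' hu' v' hv' hlt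
    by_cases hxx : tableIndex (n + 1) i' g' a' b' u' v' = x
    · obtain ⟨rfl, rfl, rfl, rfl, rfl, rfl⟩ := tableIndex_inj (by omega) (by omega) (by omega)
        (by omega) (by omega) (by omega) (by omega) (by omega) (by omega) (by omega)
        (hxx.trans hidx.symm)
      simp [hxx]
    · simp only [Function.update_of_ne hxx, hm', hm]
      exact ht _ hi' _ hg' _ ha' _ hb' _ hu' _ hv' (by omega)
  · simp [h3ρ]
  · intro j hj
    simp only [List.mem_cons, List.not_mem_nil, or_false, not_or] at hj
    simp only [Function.update_of_ne hj.1]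
    rw [hr' j (by simp [hj]), hr j (by simp [hj])]
  · exact ho'.trans ho

theorem achieves_tableProg {n B : ℕ} (hB : Room n B) :
    Achieves B tableProg (601 * (n + 1) ^ 6 + 40) (RamState.init n) (fun σ' => Params n σ' ∧
      TableUpTo n ((n + 1) ^ 6) σ' ∧ σ'.reg 13 = 0 ∧ σ'.reg 14 = 0 ∧ σ'.reg 15 = 0 ∧
      σ'.out = []) := by
  have hpow : ∀ k ≤ 6, (n + 1) ^ k ≤ B := fun k hk =>
    (Nat.pow_le_pow_right (Nat.succ_pos n) hk).trans hB.pow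
  have hn : n + 1 ≤ B := by have := hB.double; omega
  have hT : 0 < (n + 1) ^ 6 := by positivity
  refine Achieves.assign_seq ?_ ?_ (Achieves.assign_seq ?_ ?_ ?_ (by decide) (by decide) ?_)
    (by decide) (by decide) ?_
  case refine_5 =>
    -- The variant is the number of addresses left. Registers `13` to `15` and the output are
    -- carried along because the search relies on their initial values.
    refine (Achieves.loop (T := 600) (by decide) (by decide) (fun m σ => Params n σ ∧
      σ.reg 3 + m = (n + 1) ^ 6 ∧ TableUpTo n (σ.reg 3) σ ∧ σ.reg 13 = 0 ∧ σ.reg 14 = 0 ∧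
      σ.reg 15 = 0 ∧ σ.out = []) ?_ ((n + 1) ^ 6) _ ⟨?_, ?_, ?_⟩).mono ?_ ?_
    · rintro m σ ⟨hp, hm, ht, h13, h14, h15, ho⟩ hlt
      rw [hp.bound] at hlt
      refine ⟨by omega, (achieves_entryProg hB hp rfl hlt ht).mono le_rfl ?_⟩
      rintro τ ⟨ht', h3', hr, ho'⟩
      refine ⟨m - 1, by omega, hp.congr (hr 0 (by simp)) (hr 1 (by simp)) (hr 2 (by simp))
        (hr 16 (by simp)), by omega, by rwa [h3'], ?_⟩
      rw [hr 13 (by simp), hr 14 (by simp), hr 15 (by simp), ho']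
      exact ⟨h13, h14, h15, ho⟩
    · constructor <;> simp [RamState.init, ← pow_succ, ← pow_two]
    · simp [RamState.init]
    · refine ⟨?_, ?_⟩
      · intro i _ g _ a _ b _ u _ v _ h
        simp [RamState.init] at h
      · simp [RamState.init]
    · simp
    · rintro σ' ⟨⟨m, -, hp, hm, ht, h⟩, hlt⟩
      rw [hp.bound] at hlt
      exact ⟨hp, by rwa [show σ'.reg 3 = (n + 1) ^ 6 by omega] at ht, h⟩
  · simp [RamState.init]; omega
  · simp [RamState.init]; omega
  · have := hpow 2 (by norm_num)
    have := hpow 3 (by norm_num)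
    have := hpow 4 (by norm_num)
    have := hpow 5 (by norm_num)
    have := hpow 6 (by norm_num)
    simp [RamState.init, ← pow_succ, ← pow_two, *]
  · simpa [RamState.init, ← pow_succ, ← pow_two] using hB.pow
  · simp
  · simp

/-- The value of the start that places `e` cells in the even rows. -/
def startValue (n e : ℕ) : ℕ := bestFill n ((n + 1) ^ 6) n n 0 0 e (n - e)

theorem achieves_searchProg {n B : ℕ} {σ : RamState} (hB : Room n B) (hp : Params n σ)
    (ht : TableUpTo n ((n + 1) ^ 6) σ) (h13 : σ.reg 13 = 0) (h14 : σ.reg 14 = 0)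
    (h15 : σ.reg 15 = 0) (ho : σ.out = []) :
    Achieves B searchProg (201 * (n + 1) + 1) σ (fun σ' => Params n σ' ∧
      TableUpTo n ((n + 1) ^ 6) σ' ∧ σ'.reg 14 ≤ n ∧
      (∀ e ≤ n, startValue n e ≤ startValue n (σ'.reg 14)) ∧ σ'.out = []) := by
  -- Register `13` is only bounded by the value of the start in register `14`: its initial `0` need
  -- not be attained.
  refine (Achieves.loop (T := 200) (by decide) (by decide) (fun m σ => Params n σ ∧
    TableUpTo n ((n + 1) ^ 6) σ ∧ σ.reg 15 + m = n + 1 ∧ σ.reg 14 ≤ n ∧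
    (∀ e < σ.reg 15, startValue n e ≤ σ.reg 13) ∧ σ.reg 13 ≤ startValue n (σ.reg 14) ∧
    σ.out = []) ?_ (n + 1) _ ⟨hp, ht, by omega, by omega, by simp [h15], by omega, ho⟩).mono
    le_rfl ?_
  · rintro m σ ⟨hp, ht, hm, h14, hall, hbest, ho⟩ hlt
    obtain ⟨h0, h1, h2, h16⟩ := id hp
    rw [h1] at hlt
    have hle : startValue n (σ.reg 15) ≤ B := (bestFill_le _ _ _ _ _ _ _ _).trans hB.pow
    have hd := hB.double
    have hget : σ.mem (tableIndex (n + 1) n n 0 0 (σ.reg 15) (n - σ.reg 15)) =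
        startValue n (σ.reg 15) :=
      ht n le_rfl n le_rfl 0 (Nat.zero_le _) 0 (Nat.zero_le _) _ (by omega) _ (by omega)
        (tableIndex_lt le_rfl le_rfl (Nat.zero_le _) (Nat.zero_le _) (by omega) (by omega))
    refine ⟨by omega, ?_⟩
    refine Achieves.assign_seq (fits_indexExp (n := n) hB.pow h1 ?_ ?_ ?_ ?_ ?_ ?_) ?_ ?_
    case refine_8 =>
      refine Achieves.seq_sub (Q := fun τ => Params n τ ∧ TableUpTo n ((n + 1) ^ 6) τ ∧
        τ.reg 15 = σ.reg 15 ∧ τ.reg 14 ≤ n ∧ (∀ e < σ.reg 15 + 1, startValue n e ≤ τ.reg 13) ∧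
        τ.reg 13 ≤ startValue n (τ.reg 14) ∧ τ.out = []) 50
        (Achieves.ite (fun h => ?_) (fun h => ?_)) ?_
      · simp [eval_indexExp, h0, h1, hget] at h
        refine Achieves.assign_seq ?_ ?_ <| Achieves.assign ?_ ?_ ⟨?_, ht, ?_, ?_, ?_, ?_, ho⟩
        case refine_5 => constructor <;> simp [h0, h1, h2, h16]
        case refine_8 =>
          intro e he
          simp [eval_indexExp, h0, h1, hget]
          rcases Nat.lt_succ_iff_lt_or_eq.1 he with he | rfl
          · exact (hall e he).trans h.le
          · exact le_rfl
        all_goals simp [eval_indexExp, h0, h1, hget]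
        all_goals omega
      · simp [eval_indexExp, h0, h1, hget] at h
        refine Achieves.skip ⟨?_, ht, ?_, ?_, ?_, ?_, ho⟩
        case refine_1 => constructor <;> simp [h0, h1, h2, h16]
        case refine_4 =>
          intro e he
          simp
          rcases Nat.lt_succ_iff_lt_or_eq.1 he with he | rfl
          · exact hall e he
          · exact h
        all_goals simp [h14, hbest]
      · rintro τ ⟨hp, ht, h15, h14, hall, hbest, ho⟩
        refine Achieves.assign ?_ ?_ ⟨m - 1, by omega, ?_, ht, ?_, ?_, ?_, ?_, ho⟩
        case refine_3 => obtain ⟨h0, h1, h2, h16⟩ := hp; constructor <;> simp [h0, h1, h2, h16]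
        all_goals simp [h15, h14, hbest]
        · omega
        · omega
        · omega
        · intro e he; exact hall e (by omega)
    all_goals simp [eval_indexExp, h0, h1, hget]
    all_goals omega
  · rintro σ' ⟨⟨m, -, hp, ht, hm, h14, hall, hbest, ho⟩, hlt⟩
    rw [hp.base] at hlt
    exact ⟨hp, ht, h14, fun e he => (hall e (by omega)).trans hbest, ho⟩

theorem fits_placeExp {n B k j : ℕ} {σ : RamState} (hB : Room n B) (h0 : σ.reg 0 = n)
    (hk : σ.reg j = k) (hkn : k ≤ n) :
    (placeExp j).Fits B σ ∧ (placeExp j).eval σ = place n k := by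
  have hd := hB.double
  have hmod : k - k / 2 * 2 = k % 2 := by omega
  have hmul : k % 2 * k ≤ k := by
    rcases Nat.mod_two_eq_zero_or_one k with h | h <;> simp [h]
  simp only [placeExp, place, RamExp.fits_add, RamExp.fits_sub, RamExp.fits_mul, RamExp.fits_div,
    RamExp.fits_var, RamExp.fits_lit, RamExp.eval_add, RamExp.eval_sub, RamExp.eval_mul,
    RamExp.eval_div, RamExp.eval_var, RamExp.eval_lit, h0, hk, hmod]
  refine ⟨?_, trivial⟩
  refine ⟨⟨?_, ⟨⟨?_, ⟨⟨?_, ?_, ?_⟩, ?_, ?_⟩, ?_⟩, ?_, ?_⟩, ?_⟩, ⟨?_, ?_, ?_⟩, ?_⟩ <;> omega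

theorem printed_append (n : ℕ) (L L' : List (ℕ × ℕ)) :
    printed n (L ++ L') = printed n L ++ printed n L' := by
  simp [printed]

theorem rowCells_succ (i h : ℕ) : rowCells (i + 1) h = rowCells i h ++ [(i, h)] := by
  simp [rowCells, List.range_succ]

theorem achieves_printRowProg {n B i h : ℕ} {σ : RamState} (hB : Room n B) (h0 : σ.reg 0 = n)
    (h4 : σ.reg 4 = i) (hi : i ≤ n) (h17 : σ.reg 17 = h) (hh : h ≤ n) (h18 : σ.reg 18 = 0) :
    Achieves B printRowProg (101 * n + 1) σ (fun σ' => (∀ j ≠ 18, σ'.reg j = σ.reg j) ∧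
      σ'.mem = σ.mem ∧ σ'.out = σ.out ++ printed n (rowCells i h)) := by
  refine (Achieves.loop (T := 100) (by decide) (by decide) (fun m τ =>
    (∀ j ≠ 18, τ.reg j = σ.reg j) ∧ τ.mem = σ.mem ∧ τ.reg 18 + m = i ∧
    τ.out = σ.out ++ printed n (rowCells (τ.reg 18) h)) ?_ i σ ⟨fun _ _ => rfl, rfl, by omega,
      by simp [h18, printed, rowCells]⟩).mono (by nlinarith) ?_
  · rintro m τ ⟨hr, hm, hc, ho⟩ hlt
    rw [hr 4 (by simp), h4] at hlt
    have f₁ := fits_placeExp (σ := τ) hB (by rw [hr 0 (by simp), h0]) rfl (show τ.reg 18 ≤ n by omega)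
    refine ⟨by omega, Achieves.print_seq f₁.1 ?_⟩
    have f₂ := fits_placeExp (j := 17) (k := h)
      (σ := { τ with out := τ.out ++ [(placeExp 18).eval τ] }) hB
      (by simp [hr 0, h0]) (by simp [hr 17, h17]) hh
    have hd := hB.double
    refine Achieves.print_seq f₂.1 <| Achieves.assign ?_ ?_ ⟨m - 1, by omega, ?_, hm, ?_, ?_⟩
    · simp; omega
    · simp; omega
    · intro j hj; simp [hj, hr]
    · simp; omega
    · refine (congrArg (fun z => τ.out ++ [(placeExp 18).eval τ] ++ [z]) f₂.2).trans ?_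
      simp only [f₁.2, ho]
      simp [rowCells_succ, printed]
  · rintro τ ⟨⟨m, -, hr, hm, hc, ho⟩, hlt⟩
    rw [hr 4 (by simp), h4] at hlt
    rw [show τ.reg 18 = i by omega] at ho
    exact ⟨hr, hm, ho⟩

theorem achieves_rowProg {n B i g a b u v : ℕ} {σ : RamState} (hB : Room n B)
    (hp : Params n σ) (hc : Corner n i g a b u v σ) (hiu : i ≤ u) :
    Achieves B rowProg (101 * n + 101) σ (fun σ' => Params n σ' ∧
      Corner n i (g - 1) a b v (u - i) σ' ∧ σ'.mem = σ.mem ∧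
      σ'.out = σ.out ++ printed n (rowCells i (n - g))) := by
  obtain ⟨h0, h1, h2, h16⟩ := id hp
  obtain ⟨h4, h5, h6, h7, h8, h9, hi, hg, ha, hb, hu, hv⟩ := id hc
  have hd := hB.double
  refine Achieves.assign_seq ?_ ?_ (Achieves.assign_seq ?_ ?_ (Achieves.seq_sub (101 * n + 1)
    (achieves_printRowProg (i := i) (h := n - g) hB ?_ ?_ hi ?_ (by omega) ?_) ?_ ?_)
    (by decide) (by decide) ?_) (by decide) (by decide) ?_
  case refine_9 =>
    rintro τ ⟨hr, hm, ho⟩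
    have g0 := (hr 0 (by simp)).trans ((by simp [h0] : _ = n))
    have g1 := (hr 1 (by simp)).trans ((by simp [h1] : _ = n + 1))
    have g2 := (hr 2 (by simp)).trans ((by simp [h2] : _ = (n + 1) ^ 6))
    have g16 := (hr 16 (by simp)).trans ((by simp [h16] : _ = 0))
    have g4 := (hr 4 (by simp)).trans ((by simp [h4] : _ = i))
    have g5 := (hr 5 (by simp)).trans ((by simp [h5] : _ = g))
    have g6 := (hr 6 (by simp)).trans ((by simp [h6] : _ = a))
    have g7 := (hr 7 (by simp)).trans ((by simp [h7] : _ = b))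
    have g8 := (hr 8 (by simp)).trans ((by simp [h8] : _ = u))
    have g9 := (hr 9 (by simp)).trans ((by simp [h9] : _ = v))
    refine Achieves.mono (T := 60) (Achieves.assign_seq ?_ ?_ <| Achieves.assign_seq ?_ ?_ <|
      Achieves.assign_seq ?_ ?_ <| Achieves.assign ?_ ?_ ⟨?_, ?_, hm, ho⟩) ?_ (fun _ h => h)
    case refine_10 => constructor <;> simp [g0, g1, g2, g16]
    case refine_11 => constructor <;> first | omega | simp [g4, g5, g6, g7, g8, g9]
    case refine_9 => simp
    all_goals simp [g4, g5, g8, g9]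
    all_goals omega
  all_goals simp [h0, h4, h5]
  all_goals omega

theorem achieves_colProg {n B i g a b u v : ℕ} {σ : RamState} (hB : Room n B)
    (hp : Params n σ) (hc : Corner n i g a b u v σ) (hbn : b + (n - g) ≤ n) :
    Achieves B colProg 100 σ (fun σ' => Params n σ' ∧
      Corner n (i - 1) g (b + (n - g)) a u v σ' ∧ σ'.mem = σ.mem ∧ σ'.out = σ.out) := by
  obtain ⟨h0, h1, h2, h16⟩ := id hp
  obtain ⟨h4, h5, h6, h7, h8, h9, hi, hg, ha, hb, hu, hv⟩ := id hc
  have hd := hB.double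
  refine Achieves.assign_seq ?_ ?_ <| Achieves.assign_seq ?_ ?_ <|
      Achieves.assign_seq ?_ ?_ <| Achieves.assign ?_ ?_ ⟨?_, ?_, rfl, rfl⟩
  case refine_9 => constructor <;> simp [h0, h1, h2, h16]
  case refine_10 => constructor <;> first | omega | simp [h0, h4, h5, h6, h7, h8, h9]
  all_goals simp [h0, h4, h5, h6, h7]
  all_goals omega

theorem achieves_traceProg {n B : ℕ} {σ : RamState} (hB : Room n B) (hp : Params n σ)
    (ht : TableUpTo n ((n + 1) ^ 6) σ) (h14 : σ.reg 14 ≤ n) (ho : σ.out = [])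
    (hpos : 0 < startValue n (σ.reg 14)) :
    Achieves B traceProg ((101 * n + 500) * (2 * n) + 100) σ (fun σ' => ∃ L c,
      Fill n n n 0 0 (σ.reg 14) (n - σ.reg 14) L c ∧
      startValue n (σ.reg 14) + c = (n + 1) ^ 6 ∧ σ'.out = printed n L) := by
  obtain ⟨h0, h1, h2, h16⟩ := id hp
  have hd := hB.double
  set e := σ.reg 14 with he
  refine Achieves.assign_seq ?_ ?_ (Achieves.assign_seq ?_ ?_ (Achieves.assign_seq ?_ ?_
    (Achieves.assign_seq ?_ ?_ (Achieves.assign_seq ?_ ?_ (Achieves.assign_seq ?_ ?_ ?_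
    (by decide) (by decide) ?_) (by decide) (by decide) ?_) (by decide) (by decide) ?_)
    (by decide) (by decide) ?_) (by decide) (by decide) ?_) (by decide) (by decide) ?_
  case refine_13 =>
    -- A `Fill` is built from its last step backwards, while the trace runs forwards. The invariant
    -- is therefore an implication: every optimal completion of the current corner, appended to the
    -- cells printed so far, is an optimal filling from the start. The variant `i + g` drops with
    -- every boundary step.
    refine (Achieves.loop (a := 16) (b := 4) (T := 101 * n + 450) (by decide) (by decide) (fun m τ => Params n τ ∧
      TableUpTo n ((n + 1) ^ 6) τ ∧ ∃ i g a b u v L₀, Corner n i g a b u v τ ∧ i + g = m ∧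
      0 < bestFill n ((n + 1) ^ 6) i g a b u v ∧ τ.out = printed n L₀ ∧
      ∀ L c, Fill n i g a b u v L c → bestFill n ((n + 1) ^ 6) i g a b u v + c = (n + 1) ^ 6 →
        ∃ c', Fill n n n 0 0 e (n - e) (L₀ ++ L) c' ∧ startValue n e + c' = (n + 1) ^ 6)
      ?_ (n + n) _ ⟨?_, ?_, n, n, 0, 0, e, n - e, [], ?_, rfl, hpos, ?_, ?_⟩).mono ?_ ?_
    · rintro m τ ⟨hp, ht, i, g, a, b, u, v, L₀, hc, hm, hpos, ho, hL⟩ hlt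
      rw [hp.zero, hc.reg_i] at hlt
      refine ⟨by omega, ?_⟩
      obtain ⟨-, -, -, -, -, -, hi, hg, ha, hb, hu, hv⟩ := id hc
      refine Achieves.seq_sub 300 (achieves_optionsProg hB hp hc ?_ ?_) ?_ (by omega)
      · intro _ hbn
        exact ht _ (by omega) _ hg _ hbn _ ha _ hu _ hv
          (tableIndex_lt (by omega) (by omega) (by omega) (by omega) (by omega) (by omega))
      · intro _ _ _
        exact ht _ (by omega) _ (by omega) _ ha _ hb _ hv _ (by omega)
          (tableIndex_lt (by omega) (by omega) (by omega) (by omega) (by omega) (by omega))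
      rintro ρ ⟨⟨hr, hmem, hout⟩, hcol, hrow⟩
      have hpρ : Params n ρ := hp.congr (hr 0 (by simp)) (hr 1 (by simp)) (hr 2 (by simp))
        (hr 16 (by simp))
      have hcρ : Corner n i g a b u v ρ := by
        obtain ⟨h4, h5, h6, h7, h8, h9, _⟩ := hc
        constructor <;> first | assumption | simp [*]
      refine Achieves.ite (fun h => ?_) (fun h => ?_) (by decide) (by decide) (by omega)
      · rw [hcol, hrow] at h
        obtain ⟨hi0, hg0, hiu, hval⟩ := bestFill_row h
        refine (achieves_rowProg hB hpρ hcρ hiu).mono (by omega) ?_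
        rintro ω ⟨hpω, hcω, hmω, hoω⟩
        refine ⟨m - 1, by omega, hpω, ?_, i, g - 1, a, b, v, u - i, L₀ ++ rowCells i (n - g), hcω,
          by omega, by omega, ?_, ?_⟩
        · intro i hi g hg a ha b hb u hu v hv h
          rw [hmω, hmem]
          exact ht i hi g hg a ha b hb u hu v hv h
        · rw [hoω, hout, ho, printed_append]
        · intro L c hF hc
          rw [List.append_assoc]
          obtain ⟨i, rfl⟩ : ∃ j, i = j + 1 := ⟨i - 1, by omega⟩
          obtain ⟨g, rfl⟩ : ∃ j, g = j + 1 := ⟨g - 1, by omega⟩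
          exact hL _ _ (Fill.row hiu hF) (by omega)
      · rw [hcol, hrow] at h
        obtain ⟨hbn, hval⟩ := bestFill_col hlt hpos (not_lt.1 h)
        refine (achieves_colProg hB hpρ hcρ hbn).mono (by omega) ?_
        rintro ω ⟨hpω, hcω, hmω, hoω⟩
        refine ⟨m - 1, by omega, hpω, ?_, i - 1, g, b + (n - g), a, u, v, L₀, hcω,
          by omega, by omega, ?_, ?_⟩
        · intro i hi g hg a ha b hb u hu v hv h
          rw [hmω, hmem]
          exact ht i hi g hg a ha b hb u hu v hv h
        · rw [hoω, hout, ho]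
        · intro L c hF hc
          obtain ⟨i, rfl⟩ : ∃ j, i = j + 1 := ⟨i - 1, by omega⟩
          exact hL _ _ (Fill.col hbn hF) (by omega)
    · constructor <;> simp [h0, h1, h2, h16]
    · exact ht
    · constructor <;> simp [h0, ← he, h14]
    · simp [ho, printed]
    · exact fun L c hF hc => ⟨c, hF, hc⟩
    · simp; nlinarith
    · rintro τ ⟨⟨m, -, hp, -, i, g, a, b, u, v, L₀, hc, -, hpos, ho, hL⟩, hlt⟩
      rw [hp.zero, hc.reg_i] at hlt
      obtain rfl : i = 0 := by omega
      obtain ⟨rfl, rfl, hM⟩ := bestFill_zero hpos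
      -- The value at the end is exactly `M`, so the empty completion of cost `0` can be fed to the
      -- invariant.
      obtain ⟨c', hF, hc'⟩ := hL [] 0 (Fill.done g a b) hM
      exact ⟨L₀, c', by simpa using hF, hc', ho⟩
  all_goals simp [h0, ← he]
  all_goals omega

/-- The program outputs the cells of a cheapest completion of the empty diagram. -/
theorem exec_townProg {n : ℕ} (hn : ∃ e ≤ n, 0 < startValue n e) :
    ∃ s t e L c, RamExec ((n + 2) ^ 7) townProg (RamState.init n) s t ∧
      t ≤ 3000 * (n + 1) ^ 6 ∧ s.out = printed n L ∧ e ≤ n ∧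
      Fill n n n 0 0 e (n - e) L c ∧ ∀ e' ≤ n, startValue n e' + c ≤ (n + 1) ^ 6 := by
  have hB : Room n ((n + 2) ^ 7) := by
    refine ⟨?_, ?_, fun a ha b hb => ?_⟩
    · exact (Nat.pow_le_pow_left (by omega) 6).trans (Nat.pow_le_pow_right (by omega) (by omega))
    · refine le_trans ?_ (Nat.pow_le_pow_right (show 0 < n + 2 by omega) (show 2 ≤ 7 by omega))
      nlinarith
    · refine le_trans ?_ (Nat.pow_le_pow_right (show 0 < n + 2 by omega) (show 2 ≤ 7 by omega))
      nlinarith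
  have key : Achieves ((n + 2) ^ 7) townProg (3000 * (n + 1) ^ 6) (RamState.init n)
      (fun σ => ∃ e L c, σ.out = printed n L ∧ e ≤ n ∧ Fill n n n 0 0 e (n - e) L c ∧
        ∀ e' ≤ n, startValue n e' + c ≤ (n + 1) ^ 6) := by
    -- The search is linear and the trace quadratic in `n`; both are absorbed by the table.
    have h₁ : (n + 1) ^ 2 ≤ (n + 1) ^ 6 := Nat.pow_le_pow_right (by omega) (by omega)
    refine (Achieves.seq (achieves_tableProg hB) (T' := 201 * (n + 1) + 1 +
      ((101 * n + 500) * (2 * n) + 100)) ?_).mono (by nlinarith) (fun _ h => h)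
    rintro σ ⟨hp, ht, h13, h14, h15, ho⟩
    refine Achieves.seq (achieves_searchProg hB hp ht h13 h14 h15 ho) ?_
    rintro τ ⟨hp, ht, h14, hall, ho⟩
    obtain ⟨e₀, he₀, hpos⟩ := hn
    refine (achieves_traceProg hB hp ht h14 ho (hpos.trans_le (hall _ he₀))).mono le_rfl ?_
    rintro ω ⟨L, c, hF, hc, ho⟩
    exact ⟨τ.reg 14, L, c, ho, h14, hF, fun e' he' => by have := hall e' he'; omega⟩
  obtain ⟨s, σ, t, hE, hT, hA, e, L, c, ho, h⟩ := key _ ⟨fun _ _ => rfl, rfl, rfl⟩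
  exact ⟨s, t, e, L, c, hE, hT, hA.2.2.trans ho, h⟩

end program

/-! ### The cost of a diagram -/

/-- The position of the row or column `k`, relative to the centre. -/
def pos (k : ℕ) : ℤ := if k % 2 = 1 then (k + 1) / 2 else -(k / 2)

/-- The row or column `x` lies on the outer side of the cut inside `k`. -/
def outside (k x : ℕ) : Bool := decide (k ≤ x ∧ x % 2 = k % 2)

theorem outside_iff {k x : ℕ} : outside k x = true ↔ k ≤ x ∧ x % 2 = k % 2 := by
  simp [outside]

theorem place_eq {n k : ℕ} (hk : k ≤ n) : (place n k : ℤ) = n + pos k := by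
  unfold place pos
  rcases Nat.mod_two_eq_zero_or_one k with h | h <;> rw [h] <;> simp <;> omega

theorem pos_injective : Function.Injective pos := by
  intro j k h
  unfold pos at h
  split_ifs at h <;> omega

/-- The positions of `y` and `y + 2` are neighbours on the same side of the centre, and every index
below `y + 2` lies on the inner side of the outer one. -/
theorem abs_pos_sub_add_two {x y : ℕ} (h : x < y + 2) :
    |pos x - pos (y + 2)| = |pos x - pos y| + 1 := by
  unfold pos
  split_ifs <;> rcases abs_cases (_ : ℤ) with ⟨h₁, h₂⟩ | ⟨h₁, h₂⟩ <;> rw [h₁] <;>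
    rcases abs_cases (_ : ℤ) with ⟨h₃, h₄⟩ | ⟨h₃, h₄⟩ <;> rw [h₃] <;> push_cast at * <;> omega

/-- Moving the larger index inwards by two lowers the distance by one and affects only the cut at
that index. This may reverse the order of the two, so the induction is on their sum. -/
theorem abs_pos_sub_eq_sum_of_lt {n : ℕ} : ∀ m x y : ℕ, x + y ≤ m → x < y → y ≤ n →
    |pos x - pos y| = ∑ k ∈ Finset.Icc 1 n, if outside k x ≠ outside k y then (1 : ℤ) else 0 := by
  intro m
  induction m with
  | zero => intro x y h h'; omega
  | succ m ih =>
    intro x y hm hlt hy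
    have key : ∀ y', y = y' + 2 → |pos x - pos y'| = (∑ k ∈ Finset.Icc 1 n,
        if outside k x ≠ outside k y' then (1 : ℤ) else 0) → |pos x - pos y| =
        ∑ k ∈ Finset.Icc 1 n, if outside k x ≠ outside k y then (1 : ℤ) else 0 := by
      rintro y' rfl h
      rw [abs_pos_sub_add_two hlt, h]
      have h1 : (1 : ℤ) = ∑ k ∈ Finset.Icc 1 n, if k = y' + 2 then 1 else 0 := by
        rw [Finset.sum_ite_eq' (Finset.Icc 1 n) (y' + 2) fun _ => (1 : ℤ)]
        simp [hy]
      nth_rewrite 2 [h1]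
      rw [← Finset.sum_add_distrib]
      refine Finset.sum_congr rfl fun k _ => ?_
      by_cases hk : k = y' + 2
      · subst hk
        simp [outside, hlt.not_ge]
      · have : outside k (y' + 2) = outside k y' := by
          rw [Bool.eq_iff_iff, outside_iff, outside_iff]
          omega
        simp [hk, this]
    rcases y with _ | _ | y
    · omega
    · obtain rfl : x = 0 := by omega
      have h1 : |pos 0 - pos (0 + 1)| = 1 := by decide
      have h2 : (1 : ℤ) = ∑ k ∈ Finset.Icc 1 n, if k = 1 then 1 else 0 := by
        rw [Finset.sum_ite_eq' (Finset.Icc 1 n) 1 fun _ => (1 : ℤ)]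
        simp; omega
      rw [h1, h2]
      refine Finset.sum_congr rfl fun k hk => ?_
      have hk1 := (Finset.mem_Icc.1 hk).1
      have e0 : outside k 0 = false := by simp [outside]; omega
      by_cases hk : k = 1
      · subst hk; simp [outside]; omega
      · have e1 : outside k 1 = false := by simp [outside]; omega
        simp [hk, e0, e1]
    · refine key y rfl ?_
      rcases lt_trichotomy x y with h | h | h
      · exact ih x y (by omega) h (by omega)
      · subst h; simp
      · rw [abs_sub_comm, ih y x (by omega) h (by omega)]
        refine Finset.sum_congr rfl fun k _ => ?_
        simp only [ne_comm]

/-- The distance of two positions is the number of cuts that separate them. -/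
theorem abs_pos_sub_eq_sum {n x y : ℕ} (hx : x ≤ n) (hy : y ≤ n) :
    |pos x - pos y| = ∑ k ∈ Finset.Icc 1 n, if outside k x ≠ outside k y then (1 : ℤ) else 0 := by
  rcases lt_trichotomy x y with h | h | h
  · exact abs_pos_sub_eq_sum_of_lt _ x y le_rfl h hy
  · subst h; simp
  · rw [abs_sub_comm, abs_pos_sub_eq_sum_of_lt _ y x le_rfl h hx]
    refine Finset.sum_congr rfl fun k _ => ?_
    simp only [ne_comm]

/-- For indicators `p` and `q`, being different is `p + q - 2 * p * q`, so the double sum factors.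
-/
theorem sum_sum_ne_eq {α : Type*} (F : Finset α) (P : α → Bool) :
    (∑ p ∈ F, ∑ q ∈ F, if P p ≠ P q then (1 : ℤ) else 0) =
      2 * ((F.filter fun p => P p = true).card * (F.card - (F.filter fun p => P p = true).card)) := by
  have h : ∀ p q, (if P p ≠ P q then (1 : ℤ) else 0) = (if P p = true then 1 else 0) +
      (if P q = true then 1 else 0) - 2 * ((if P p = true then 1 else 0) *
        (if P q = true then 1 else 0)) := by
    intro p q
    cases P p <;> cases P q <;> simp
  simp only [h, Finset.sum_sub_distrib, Finset.sum_add_distrib, ← Finset.mul_sum,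
    ← Finset.sum_mul, Finset.sum_const, Finset.sum_boole, nsmul_eq_mul]
  ring

/-- The number of cells of `L` outside the cut inside column `k`. -/
def colCount (k : ℕ) (L : List (ℕ × ℕ)) : ℕ := L.countP fun p => outside k p.1

/-- The number of cells of `L` outside the cut inside row `k`. -/
def rowCount (k : ℕ) (L : List (ℕ × ℕ)) : ℕ := L.countP fun p => outside k p.2

theorem countP_eq_card_filter {α : Type*} [DecidableEq α] {L : List α} (hL : L.Nodup)
    (P : α → Bool) : L.countP P = (L.toFinset.filter fun p => P p = true).card := by
  rw [List.countP_eq_length_filter, ← List.toFinset_filter, List.toFinset_card_of_nodup]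
  exact hL.filter _

/-- The pairwise distances of the cells of a set, placed around the centre. -/
def diagramCost (F : Finset (ℕ × ℕ)) : ℤ :=
  ∑ p ∈ F, ∑ q ∈ F, (|pos p.1 - pos q.1| + |pos p.2 - pos q.2|)

theorem diagramCost_eq {n : ℕ} {L : List (ℕ × ℕ)} (hL : L.Nodup) (hn : L.length = n)
    (hle : ∀ p ∈ L, p.1 ≤ n ∧ p.2 ≤ n) :
    diagramCost L.toFinset = ((2 * (∑ k ∈ Finset.Icc 1 n, colCount k L * (n - colCount k L) +
      ∑ k ∈ Finset.Icc 1 n, rowCount k L * (n - rowCount k L)) : ℕ) : ℤ) := by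
  have hcut : ∀ f : ℕ × ℕ → ℕ, (∀ p ∈ L, f p ≤ n) →
      (∑ p ∈ L.toFinset, ∑ q ∈ L.toFinset, |pos (f p) - pos (f q)|) =
      2 * ∑ k ∈ Finset.Icc 1 n, (((L.countP fun p => outside k (f p)) *
        (n - (L.countP fun p => outside k (f p))) : ℕ) : ℤ) := by
    intro f hf
    have h : ∀ p ∈ L.toFinset, ∀ q ∈ L.toFinset, |pos (f p) - pos (f q)| =
        ∑ k ∈ Finset.Icc 1 n, if outside k (f p) ≠ outside k (f q) then (1 : ℤ) else 0 :=
      fun p hp q hq => abs_pos_sub_eq_sum (hf p (List.mem_toFinset.1 hp))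
        (hf q (List.mem_toFinset.1 hq))
    rw [Finset.sum_congr rfl fun p hp => Finset.sum_congr rfl (h p hp)]
    rw [Finset.sum_congr rfl fun p _ => Finset.sum_comm, Finset.sum_comm, Finset.mul_sum]
    refine Finset.sum_congr rfl fun k _ => ?_
    rw [sum_sum_ne_eq _ fun p => outside k (f p), List.toFinset_card_of_nodup hL, hn,
      countP_eq_card_filter hL]
    have := (Finset.card_filter_le L.toFinset fun p => outside k (f p) = true).trans_eq
      ((List.toFinset_card_of_nodup hL).trans hn)
    push_cast [this]
    ring
  simp only [diagramCost, Finset.sum_add_distrib]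
  rw [hcut Prod.fst fun p hp => (hle p hp).1, hcut Prod.snd fun p hp => (hle p hp).2]
  simp only [colCount, rowCount]
  push_cast
  ring

/-- The town in which the cells `L` are placed. -/
def placedTown (n : ℕ) (L : List (ℕ × ℕ)) : Finset (ℤ × ℤ) :=
  ((L.map fun p => (place n p.1, place n p.2)).map fun p => ((p.1 : ℤ), (p.2 : ℤ))).toFinset

theorem place_injOn {n j k : ℕ} (hj : j ≤ n) (hk : k ≤ n) (h : place n j = place n k) : j = k := by
  have h' : (place n j : ℤ) = place n k := by rw [h]
  rw [place_eq hj, place_eq hk] at h'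
  exact pos_injective (by linarith)

theorem placedTown_spec {n : ℕ} {L : List (ℕ × ℕ)} (hL : L.Nodup)
    (hle : ∀ p ∈ L, p.1 ≤ n ∧ p.2 ≤ n) :
    ListsTown (printed n L) (placedTown n L) ∧ (placedTown n L).card = L.length ∧
      townCost (placedTown n L) = (1 / 2 : ℚ) * (diagramCost L.toFinset : ℚ) := by
  have hinj : ∀ p ∈ L, ∀ q ∈ L, (place n p.1, place n p.2) = (place n q.1, place n q.2) → p = q := by
    intro p hp q hq h
    rw [Prod.mk.injEq] at h
    exact Prod.ext (place_injOn (hle p hp).1 (hle q hq).1 h.1)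
      (place_injOn (hle p hp).2 (hle q hq).2 h.2)
  have hnd : (L.map fun p => (place n p.1, place n p.2)).Nodup :=
    List.Nodup.map_on hinj hL
  have hF : placedTown n L = L.toFinset.image fun p => ((place n p.1 : ℤ), (place n p.2 : ℤ)) := by
    ext x
    simp [placedTown]
  have hinj' : Set.InjOn (fun p : ℕ × ℕ => ((place n p.1 : ℤ), (place n p.2 : ℤ)))
      L.toFinset := by
    intro p hp q hq h
    simp only [Prod.mk.injEq, Nat.cast_inj] at h
    exact hinj p (by simpa using hp) q (by simpa using hq) (Prod.ext h.1 h.2)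
  refine ⟨⟨_, hnd, rfl, rfl⟩, ?_, ?_⟩
  · rw [hF, Finset.card_image_of_injOn hinj', List.toFinset_card_of_nodup hL]
  · rw [townCost, hF, Finset.sum_image hinj', diagramCost]
    push_cast
    congr 1
    refine Finset.sum_congr rfl fun p hp => ?_
    rw [Finset.sum_image hinj']
    refine Finset.sum_congr rfl fun q hq => ?_
    have hp' := hle p (List.mem_toFinset.1 hp)
    have hq' := hle q (List.mem_toFinset.1 hq)
    simp only [manhattan, place_eq hp'.1, place_eq hp'.2, place_eq hq'.1, place_eq hq'.2]
    push_cast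
    congr 2 <;> ring

/-- If row `k` holds no cell, cut `k` can be pushed outwards to `k + 2`; this is why `u` and `v`
trade places when a row is closed. -/
theorem rowCount_eq_of_parity {k : ℕ} {L : List (ℕ × ℕ)} (h : ∀ p ∈ L, k < p.2) :
    rowCount k L = rowCount (k + 2) L := by
  refine List.countP_congr fun p hp => ?_
  have := h p hp
  rw [outside_iff, outside_iff]
  omega

theorem rowCount_rowCells_append (k i h : ℕ) (L : List (ℕ × ℕ)) :
    rowCount k (rowCells i h ++ L) = (if outside k h then i else 0) + rowCount k L := by
  simp only [rowCount, rowCells, List.countP_append, List.countP_map, Function.comp_def]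
  split_ifs with hk <;> simp [hk]

theorem colCount_rowCells_append (k i h : ℕ) (L : List (ℕ × ℕ)) :
    colCount k (rowCells i h ++ L) = (List.range i).countP (outside k) + colCount k L := by
  simp only [colCount, rowCells, List.countP_append, List.countP_map, Function.comp_def]

theorem mem_rowCells {i h : ℕ} {p : ℕ × ℕ} : p ∈ rowCells i h ↔ p.1 < i ∧ p.2 = h := by
  rcases p with ⟨x, y⟩
  simp [rowCells, eq_comm]

theorem nodup_rowCells (i h : ℕ) : (rowCells i h).Nodup :=
  List.nodup_range.map fun _ _ hxy => congrArg Prod.fst hxy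

/-- For an open column cut `k ≤ i`, the outer cells are those of `L`, those of the full rectangle
below row `n - g` in the columns before `i`, and those in the columns from `i` on, which number `a`
or `b` by parity. A column step settles cut `i`; a row step moves one row from the rectangle to `L`.
-/
theorem Fill.spec {n i g a b u v c : ℕ} {L : List (ℕ × ℕ)} (hF : Fill n i g a b u v L c)
    (hg : g ≤ n) :
    (∀ p ∈ L, p.1 < i ∧ n - g ≤ p.2 ∧ p.2 < n) ∧ L.Nodup ∧ rowCount (n - g) L = u ∧
      rowCount (n - g + 1) L = v ∧
      c = (∑ k ∈ Finset.Icc 1 i,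
          let m := colCount k L + (n - g) * (List.range i).countP (outside k) +
            if k % 2 = i % 2 then a else b
          m * (n - m)) +
        ∑ k ∈ Finset.Ioc (n - g) n, rowCount k L * (n - rowCount k L) := by
  induction hF with
  | done => simp [rowCount]
  | @col i g a b u v L c h _ ih =>
    obtain ⟨h₁, h₂, h₃, h₄, h₅⟩ := ih hg
    refine ⟨fun p hp => ⟨by have := h₁ p hp; omega, (h₁ p hp).2⟩, h₂, h₃, h₄, ?_⟩
    rw [h₅, Finset.sum_Icc_succ_top (by omega)]
    have e₁ : colCount (i + 1) L = 0 := by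
      refine List.countP_eq_zero.2 fun p hp => ?_
      have := h₁ p hp
      rw [outside_iff]; omega
    have e₂ : (List.range (i + 1)).countP (outside (i + 1)) = 0 := by
      refine List.countP_eq_zero.2 fun p hp => ?_
      have := List.mem_range.1 hp
      rw [outside_iff]; omega
    simp only [e₁, e₂, if_true, Nat.mul_zero, Nat.zero_add]
    -- The `n - g` cells of column `i` are counted with the closed columns on the left and with the
    -- rectangle on the right.
    have e₃ : ∀ k ∈ Finset.Icc 1 i, (colCount k L + (n - g) * (List.range i).countP (outside k) +
        if k % 2 = i % 2 then b + (n - g) else a) =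
        colCount k L + (n - g) * (List.range (i + 1)).countP (outside k) +
          if k % 2 = (i + 1) % 2 then a else b := by
      intro k hk
      have hk := Finset.mem_Icc.1 hk
      rw [List.range_succ, List.countP_append]
      by_cases hp : k % 2 = i % 2
      · have hp' : ¬ k % 2 = (i + 1) % 2 := by omega
        have ho : outside k i = true := outside_iff.2 ⟨hk.2, hp.symm⟩
        rw [if_pos hp, if_neg hp', List.countP_singleton, if_pos ho]
        ring
      · have hp' : k % 2 = (i + 1) % 2 := by omega
        have ho : ¬ outside k i = true := by rw [outside_iff]; omega
        rw [if_neg hp, if_pos hp', List.countP_singleton, if_neg ho]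
        ring
    rw [Finset.sum_congr rfl fun k hk => by rw [e₃ k hk]]
    ring
  | @row i g a b u v L c h _ ih =>
    obtain ⟨h₁, h₂, h₃, h₄, h₅⟩ := ih (by omega)
    obtain ⟨y, hy⟩ : ∃ y, n - (g + 1) = y := ⟨_, rfl⟩
    have hy' : n - g = y + 1 := by omega
    rw [hy'] at h₁ h₃ h₄ h₅
    rw [hy]
    refine ⟨?_, ?_, ?_, ?_, ?_⟩
    · intro p hp
      rw [List.mem_append, mem_rowCells] at hp
      rcases hp with hp | hp
      · omega
      · have := h₁ p hp; omega
    · refine List.nodup_append.2 ⟨nodup_rowCells _ _, h₂, ?_⟩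
      rintro p hp q hq rfl
      have := (mem_rowCells.1 hp).2
      have := h₁ p hq
      omega
    · rw [rowCount_rowCells_append, if_pos (outside_iff.2 ⟨le_rfl, rfl⟩),
        rowCount_eq_of_parity fun p hp => by have := h₁ p hp; omega, h₄]
      omega
    · rw [rowCount_rowCells_append, if_neg (by rw [outside_iff]; omega), h₃, Nat.zero_add]
    · have e : Finset.Ioc y n = insert (y + 1) (Finset.Ioc (y + 1) n) := by
        ext k; simp only [Finset.mem_Ioc, Finset.mem_insert]; omega
      rw [e, Finset.sum_insert (by simp), rowCount_rowCells_append,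
        if_neg (by rw [outside_iff]; omega), h₃, Nat.zero_add, h₅]
      have e₁ : ∑ k ∈ Finset.Ioc (y + 1) n, rowCount k (rowCells (i + 1) y ++ L) *
          (n - rowCount k (rowCells (i + 1) y ++ L)) =
          ∑ k ∈ Finset.Ioc (y + 1) n, rowCount k L * (n - rowCount k L) := by
        refine Finset.sum_congr rfl fun k hk => ?_
        have := (Finset.mem_Ioc.1 hk).1
        rw [rowCount_rowCells_append, if_neg (by rw [outside_iff]; omega), Nat.zero_add]
      -- The row at height `y` is counted in the rectangle on the left and in the list on the right.
      have e₂ : ∀ k, colCount k L + (y + 1) * (List.range (i + 1)).countP (outside k) =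
          colCount k (rowCells (i + 1) y ++ L) + y * (List.range (i + 1)).countP (outside k) := by
        intro k
        rw [colCount_rowCells_append]
        ring
      rw [e₁]
      simp only [e₂]
      ring

theorem rowCount_zero_add_one (L : List (ℕ × ℕ)) : rowCount 0 L + rowCount 1 L = L.length := by
  rw [List.length_eq_countP_add_countP (fun p : ℕ × ℕ => outside 0 p.2)]
  congr 1
  refine List.countP_congr fun p _ => ?_
  simp only [outside, decide_eq_true_eq]
  omega

/-- The cost of filling the empty diagram is the cost of the town. -/
theorem Fill.town {n e c : ℕ} {L : List (ℕ × ℕ)} (he : e ≤ n)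
    (hF : Fill n n n 0 0 e (n - e) L c) :
    ListsTown (printed n L) (placedTown n L) ∧ (placedTown n L).card = n ∧
      townCost (placedTown n L) = c ∧ (diagramCost L.toFinset : ℚ) = 2 * c := by
  obtain ⟨h₁, h₂, h₃, h₄, h₅⟩ := hF.spec le_rfl
  rw [Nat.sub_self] at h₃ h₄ h₅
  have hlen : L.length = n := by rw [← rowCount_zero_add_one, h₃, h₄]; omega
  have hle : ∀ p ∈ L, p.1 ≤ n ∧ p.2 ≤ n := fun p hp => by have := h₁ p hp; omega
  obtain ⟨k₁, k₂, k₃⟩ := placedTown_spec h₂ hle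
  have hcost : diagramCost L.toFinset = ((2 * c : ℕ) : ℤ) := by
    rw [diagramCost_eq h₂ hlen hle, h₅]
    simp
    rfl
  refine ⟨k₁, k₂.trans hlen, ?_, ?_⟩
  · rw [k₃, hcost]; push_cast; ring
  · rw [hcost]; push_cast; ring

/-! ### Compressing a town to a diagram -/

/-- The positions of `p` and `p + 1` are the two ends of the interval filled by the first `p + 2`
positions, and `pos k` lies between them. -/
theorem abs_pos_add_abs_pos {p k : ℕ} (hk : k < p + 2) :
    |pos p - pos k| + |pos (p + 1) - pos k| = p + 1 := by
  unfold pos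
  split_ifs <;> rcases abs_cases (_ : ℤ) with ⟨h₁, h₂⟩ | ⟨h₁, h₂⟩ <;> rw [h₁] <;>
    rcases abs_cases (_ : ℤ) with ⟨h₃, h₄⟩ | ⟨h₃, h₄⟩ <;> rw [h₃] <;> push_cast at * <;> omega

/-- Among all sets of given sizes, the centred ones have the least total distance. -/
theorem sum_abs_pos_le : ∀ (m : ℕ) (A B : Finset ℤ), A.card + B.card ≤ m →
    ∑ j ∈ Finset.range A.card, ∑ k ∈ Finset.range B.card, |pos j - pos k| ≤
      ∑ a ∈ A, ∑ b ∈ B, |a - b| := by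
  intro m
  induction m with
  | zero =>
    intro A B h
    have : A.card = 0 := by omega
    simp [Finset.card_eq_zero.1 this]
  | succ m ih =>
    have key : ∀ A B : Finset ℤ, A.card + B.card ≤ m + 1 → B.card ≤ A.card →
        ∑ j ∈ Finset.range A.card, ∑ k ∈ Finset.range B.card, |pos j - pos k| ≤
          ∑ a ∈ A, ∑ b ∈ B, |a - b| := by
      intro A B h hBA
      have hnn : 0 ≤ ∑ a ∈ A, ∑ b ∈ B, |a - b| :=
        Finset.sum_nonneg fun a _ => Finset.sum_nonneg fun b _ => abs_nonneg _
      rcases Nat.lt_or_ge A.card 2 with h2 | h2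
      · refine le_trans (le_of_eq ?_) hnn
        refine Finset.sum_eq_zero fun j hj => Finset.sum_eq_zero fun k hk => ?_
        have := Finset.mem_range.1 hj
        have := Finset.mem_range.1 hk
        obtain rfl : j = 0 := by omega
        obtain rfl : k = 0 := by omega
        simp
      · have hne : A.Nonempty := Finset.card_pos.1 (by omega)
        obtain ⟨p, hp⟩ : ∃ p, A.card = p + 2 := ⟨A.card - 2, by omega⟩
        -- Remove the two extremes of the larger set. Together they cost at least `y - x ≥ p + 1`
        -- against each point of `B`; the centred positions `p` and `p + 1` attain this because `B`
        -- is not larger than `A`.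
        set x := A.min' hne with hx
        set y := A.max' hne with hy
        have hxA : x ∈ A := A.min'_mem hne
        have hyA : y ∈ A := A.max'_mem hne
        have hsub : A ⊆ Finset.Icc x y := fun a ha =>
          Finset.mem_Icc.2 ⟨A.min'_le a ha, A.le_max' a ha⟩
        have hcard := Finset.card_le_card hsub
        rw [Int.card_Icc, hp] at hcard
        have hyA' : y ∈ A.erase x := Finset.mem_erase.2 ⟨by omega, hyA⟩
        have hA' : ((A.erase x).erase y).card = p := by
          rw [Finset.card_erase_of_mem hyA', Finset.card_erase_of_mem hxA, hp]
          omega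
        have hih := ih ((A.erase x).erase y) B (by omega)
        rw [hA'] at hih
        rw [← Finset.add_sum_erase A _ hxA, ← Finset.add_sum_erase _ _ hyA', hp,
          Finset.sum_range_succ, Finset.sum_range_succ]
        have h₁ : (∑ k ∈ Finset.range B.card, |pos p - pos k|) +
            ∑ k ∈ Finset.range B.card, |pos (p + 1) - pos k| = B.card * (p + 1) := by
          rw [← Finset.sum_add_distrib, Finset.sum_congr rfl fun k hk =>
            abs_pos_add_abs_pos (p := p) (by have := Finset.mem_range.1 hk; omega)]
          simp
        have h₂ : (B.card * (p + 1) : ℤ) ≤ (∑ b ∈ B, |x - b|) + ∑ b ∈ B, |y - b| := by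
          rw [← Finset.sum_add_distrib, ← nsmul_eq_mul]
          refine Finset.card_nsmul_le_sum _ _ _ fun b _ => ?_
          have h₃ := neg_abs_le (x - b)
          have h₄ := le_abs_self (y - b)
          omega
        linarith
    intro A B h
    rcases le_total B.card A.card with hBA | hBA
    · exact key A B h hBA
    · refine (le_of_eq ?_).trans ((key B A (by omega) hBA).trans (le_of_eq ?_))
      all_goals
        rw [Finset.sum_comm]
        exact Finset.sum_congr rfl fun _ _ => Finset.sum_congr rfl fun _ _ => abs_sub_comm _ _

section compress

variable {α : Type*} [DecidableEq α]

/-- The second coordinates of the points with a given first coordinate. -/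
def fiber (S : Finset (α × ℤ)) (x : α) : Finset ℤ := (S.filter fun s => s.1 = x).image Prod.snd

theorem mem_fiber {S : Finset (α × ℤ)} {x : α} {y : ℤ} : y ∈ fiber S x ↔ (x, y) ∈ S := by
  simp [fiber]

/-- Replace the second coordinates of the points with a given first coordinate by `0, 1, …`. -/
def compress (S : Finset (α × ℤ)) : Finset (α × ℕ) :=
  (S.image Prod.fst).biUnion fun x => (Finset.range (fiber S x).card).image fun j => (x, j)

theorem mem_compress {S : Finset (α × ℤ)} {x : α} {j : ℕ} :
    (x, j) ∈ compress S ↔ j < (fiber S x).card := by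
  simp only [compress, Finset.mem_biUnion, Finset.mem_image, Finset.mem_range, Prod.mk.injEq]
  constructor
  · rintro ⟨_, _, j', hj, rfl, rfl⟩
    exact hj
  · intro hj
    obtain ⟨y, hy⟩ := Finset.card_pos.1 (Nat.zero_lt_of_lt hj)
    exact ⟨x, ⟨_, mem_fiber.1 hy, rfl⟩, j, hj, rfl, rfl⟩

theorem sum_eq_sum_fiber (S : Finset (α × ℤ)) (f : α → ℤ → ℤ) :
    ∑ s ∈ S, f s.1 s.2 = ∑ x ∈ S.image Prod.fst, ∑ y ∈ fiber S x, f x y := by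
  rw [← Finset.sum_fiberwise_of_maps_to (t := S.image Prod.fst) (g := Prod.fst)
    fun s hs => Finset.mem_image_of_mem _ hs]
  refine Finset.sum_congr rfl fun x _ => ?_
  rw [fiber, Finset.sum_image]
  · refine Finset.sum_congr rfl fun s hs => ?_
    rw [(Finset.mem_filter.1 hs).2]
  · intro s hs t ht h
    exact Prod.ext ((Finset.mem_filter.1 hs).2.trans (Finset.mem_filter.1 ht).2.symm) h

theorem sum_compress (S : Finset (α × ℤ)) (f : α → ℕ → ℤ) :
    ∑ s ∈ compress S, f s.1 s.2 =
      ∑ x ∈ S.image Prod.fst, ∑ j ∈ Finset.range (fiber S x).card, f x j := by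
  rw [compress, Finset.sum_biUnion]
  · refine Finset.sum_congr rfl fun x _ => ?_
    rw [Finset.sum_image fun i _ j _ h => congrArg Prod.snd h]
  · intro x _ x' _ hne
    rw [Function.onFun, Finset.disjoint_left]
    rintro ⟨z, j⟩ h h'
    simp only [Finset.mem_image, Prod.mk.injEq] at h h'
    obtain ⟨_, _, rfl, _⟩ := h
    obtain ⟨_, _, rfl, _⟩ := h'
    exact hne rfl

/-- Fibre sizes are preserved, hence so is the multiset of first coordinates. -/
theorem sum_fst_compress (S : Finset (α × ℤ)) (f : α → ℤ) :
    ∑ s ∈ compress S, f s.1 = ∑ s ∈ S, f s.1 := by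
  rw [sum_compress S fun x _ => f x, sum_eq_sum_fiber S fun x _ => f x]
  simp

/-- Split both sums by fibres and apply `sum_abs_pos_le` to each pair of fibres. -/
theorem sum_snd_compress_le (S : Finset (α × ℤ)) :
    ∑ s ∈ compress S, ∑ t ∈ compress S, |pos s.2 - pos t.2| ≤
      ∑ s ∈ S, ∑ t ∈ S, |s.2 - t.2| := by
  rw [sum_compress S fun _ j => ∑ t ∈ compress S, |pos j - pos t.2|,
    sum_eq_sum_fiber S fun _ y => ∑ t ∈ S, |y - t.2|]
  refine Finset.sum_le_sum fun x _ => ?_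
  simp only [fun j => sum_compress S fun _ k => |pos j - pos k|,
    fun y => sum_eq_sum_fiber S fun _ z => |y - z|]
  rw [Finset.sum_comm, Finset.sum_comm (s := fiber S x)]
  exact Finset.sum_le_sum fun x' _ => sum_abs_pos_le _ _ _ le_rfl

end compress

/-- Any town can be compressed to a Young diagram without increasing the cost. -/
theorem exists_diagram (S : Finset (ℤ × ℤ)) : ∃ r : ℕ → ℕ, Antitone r ∧
    ∃ D : Finset (ℕ × ℕ), (∀ k j, (k, j) ∈ D ↔ k < r j) ∧ D.card = S.card ∧
      (diagramCost D : ℚ) ≤ 2 * townCost S := by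
  -- Compress the columns, swap coordinates, compress the rows, swap back.
  set T := (compress S).map (Equiv.prodComm ℤ ℕ).toEmbedding with hT
  set D := (compress T).map (Equiv.prodComm ℕ ℕ).toEmbedding with hD
  have hmemT : ∀ j x, (j, x) ∈ T ↔ j < (fiber S x).card := by
    intro j x
    rw [← mem_compress, hT]
    simp
  refine ⟨fun j => (fiber T j).card, fun j j' h => ?_, D, fun k j => ?_, ?_, ?_⟩
  -- Row `j` of `T` consists of the columns of height more than `j`, so the rows are nested.
  · refine Finset.card_le_card fun x hx => ?_
    rw [mem_fiber, hmemT] at hx ⊢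
    exact h.trans_lt hx
  · rw [← mem_compress, hD]
    simp
  · have h₁ := sum_fst_compress T fun _ => 1
    have h₂ := sum_fst_compress S fun _ => 1
    simp only [Finset.sum_const, nsmul_eq_mul, mul_one, Nat.cast_inj] at h₁ h₂
    rw [hD, Finset.card_map, h₁, hT, Finset.card_map, h₂]
  · have hcost : townCost S * 2 = ((∑ s ∈ S, ∑ t ∈ S, (|s.1 - t.1| + |s.2 - t.2|) : ℤ) : ℚ) := by
      simp only [townCost, manhattan]
      push_cast
      ring
    rw [mul_comm, hcost]
    norm_cast
    have hsnd := sum_snd_compress_le S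
    have hfst := sum_snd_compress_le T
    -- Each compression leaves the distances in the other coordinate unchanged; for the second one,
    -- these are the already centred vertical distances.
    have e₁ : ∑ s ∈ T, ∑ t ∈ T, |s.2 - t.2| = ∑ s ∈ S, ∑ t ∈ S, |s.1 - t.1| := by
      simp only [hT, Finset.sum_map, Equiv.coe_toEmbedding, Equiv.prodComm_apply, Prod.snd_swap]
      rw [sum_fst_compress S fun x => ∑ t ∈ compress S, |x - t.1|]
      exact Finset.sum_congr rfl fun s _ => sum_fst_compress S fun x => |s.1 - x|
    have e₂ : ∑ s ∈ compress T, ∑ t ∈ compress T, |pos s.1 - pos t.1| =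
        ∑ s ∈ compress S, ∑ t ∈ compress S, |pos s.2 - pos t.2| := by
      rw [sum_fst_compress T fun x => ∑ t ∈ compress T, |pos x - pos t.1|]
      rw [Finset.sum_congr rfl fun s _ => sum_fst_compress T fun x => |pos s.1 - pos x|]
      simp only [hT, Finset.sum_map, Equiv.coe_toEmbedding, Equiv.prodComm_apply, Prod.fst_swap]
    simp only [diagramCost, hD, Finset.sum_map, Equiv.coe_toEmbedding, Equiv.prodComm_apply,
      Prod.fst_swap, Prod.snd_swap, Finset.sum_add_distrib]
    rw [e₂]
    linarith

/-! ### Every diagram can be filled -/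

/-- The sum of the entries at even places. -/
def altSum : List ℕ → ℕ
  | [] => 0
  | [r] => r
  | r :: _ :: l => r + altSum l

theorem altSum_cons (r : ℕ) (l : List ℕ) : altSum (r :: l) = r + altSum l.tail := by
  cases l <;> rfl

theorem altSum_add_altSum_tail : ∀ l : List ℕ, altSum l + altSum l.tail = l.sum
  | [] => rfl
  | r :: l => by
    have h := altSum_add_altSum_tail l
    rw [List.sum_cons, altSum_cons, List.tail_cons]
    omega

/-- The cells of a diagram with given row lengths, starting with row `h`. -/
def diagramCells : ℕ → List ℕ → List (ℕ × ℕ)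
  | _, [] => []
  | h, r :: l => rowCells r h ++ diagramCells (h + 1) l

theorem mem_diagramCells : ∀ (l : List ℕ) (h k j : ℕ),
    (k, j) ∈ diagramCells h l ↔ h ≤ j ∧ k < l.getD (j - h) 0
  | [], h, k, j => by simp [diagramCells]
  | r :: l, h, k, j => by
    rw [diagramCells, List.mem_append, mem_rowCells, mem_diagramCells l (h + 1) k j]
    rcases lt_trichotomy j h with hj | rfl | hj
    · constructor
      · rintro (h | h) <;> omega
      · omega
    · simp
    · obtain ⟨d, rfl⟩ := Nat.exists_eq_add_of_lt hj
      have e₁ : h + d + 1 - h = d + 1 := by omega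
      have e₂ : h + d + 1 - (h + 1) = d := by omega
      rw [e₁, e₂, List.getD_cons_succ]
      constructor
      · rintro (h | h) <;> omega
      · exact fun h => Or.inr ⟨by omega, h.2⟩

theorem length_diagramCells : ∀ (l : List ℕ) (h : ℕ), (diagramCells h l).length = l.sum
  | [], _ => rfl
  | r :: l, h => by simp [diagramCells, rowCells, length_diagramCells l (h + 1)]

theorem nodup_diagramCells : ∀ (l : List ℕ) (h : ℕ), (diagramCells h l).Nodup
  | [], _ => List.nodup_nil
  | r :: l, h => by
    refine List.nodup_append.2 ⟨nodup_rowCells _ _, nodup_diagramCells l (h + 1), ?_⟩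
    rintro ⟨k, j⟩ hp q hq rfl
    have := (mem_rowCells.1 hp).2
    have := ((mem_diagramCells _ _ _ _).1 hq).1
    simp only at *
    omega

/-- Follow the boundary: close a row if the next one has full length `i`, otherwise a column. The
last hypothesis counts all cells (closed columns, rectangle, remaining rows); it keeps the column
counts within `n`. -/
theorem exists_fill {n : ℕ} : ∀ (m i g a b : ℕ) (l : List ℕ), i + l.length ≤ m → g ≤ n →
    (∀ r ∈ l, 0 < r ∧ r ≤ i) → l.Pairwise (· ≥ ·) →
    a + b + i * (n - g) + altSum l + altSum l.tail = n →
    ∃ c, Fill n i g a b (altSum l) (altSum l.tail) (diagramCells (n - g) l) c := by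
  intro m
  induction m with
  | zero =>
    intro i g a b l hm hg hl hs hn
    obtain rfl : i = 0 := by omega
    obtain rfl : l = [] := List.length_eq_zero_iff.1 (by omega)
    exact ⟨0, Fill.done g a b⟩
  | succ m ih =>
    intro i g a b l hm hg hl hs hn
    rcases i with _ | i
    · rcases l with _ | ⟨r, l⟩
      · exact ⟨0, Fill.done g a b⟩
      · have := hl r (by simp)
        omega
    · have hcol : (∀ r ∈ l, 0 < r ∧ r ≤ i) →
          ∃ c, Fill n (i + 1) g a b (altSum l) (altSum l.tail) (diagramCells (n - g) l) c := by
        intro hl'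
        rw [Nat.add_mul, Nat.one_mul] at hn
        obtain ⟨c, hc⟩ := ih i g (b + (n - g)) a l (by omega) hg hl' hs (by omega)
        exact ⟨_, Fill.col (by omega) hc⟩
      rcases l with _ | ⟨r, l⟩
      · exact hcol (by simp)
      · obtain ⟨hr, hs'⟩ := List.pairwise_cons.1 hs
        rcases Nat.lt_or_ge r (i + 1) with hri | hri
        · refine hcol fun r' hr' => ⟨(hl r' hr').1, ?_⟩
          rcases List.mem_cons.1 hr' with rfl | hr'
          · omega
          · exact (hr r' hr').trans (by omega)
        · obtain rfl : r = i + 1 := le_antisymm (hl r (by simp)).2 hri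
          have hmul := Nat.le_mul_of_pos_left (n - g) (Nat.succ_pos i)
          simp only [altSum_cons, List.tail_cons] at hn ⊢
          rw [Nat.succ_eq_add_one] at hmul
          -- With `g = 0`, the rectangle and the next row would hold more than `n` cells.
          obtain ⟨g, rfl⟩ : ∃ g', g = g' + 1 := ⟨g - 1, by omega⟩
          have hg' : n - g = n - (g + 1) + 1 := by omega
          have hn' : a + b + (i + 1) * (n - g) + altSum l + altSum l.tail = n := by
            rw [hg', Nat.mul_add, Nat.mul_one]
            omega
          have hlen : i + 1 + l.length ≤ m := by
            rw [List.length_cons] at hm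
            omega
          obtain ⟨c, hc⟩ := ih (i + 1) g a b l hlen (by omega)
            (fun r' hr' => hl r' (List.mem_cons_of_mem _ hr')) hs' hn'
          have e : altSum l.tail = i + 1 + altSum l.tail - (i + 1) := by omega
          rw [e, hg'] at hc
          exact ⟨_, Fill.row (Nat.le_add_right _ _) hc⟩

theorem exists_fill_le (S : Finset (ℤ × ℤ)) : ∃ e ≤ S.card, ∃ L c,
    Fill S.card S.card S.card 0 0 e (S.card - e) L c ∧ (c : ℚ) ≤ townCost S := by
  obtain ⟨r, hr, D, hD, hcard, hcost⟩ := exists_diagram S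
  generalize S.card = n at hcard ⊢
  -- With no empty row, the first column would contain more than `n` cells.
  have hz : ∃ j, r j = 0 := by
    by_contra h
    push Not at h
    have hsub : (Finset.range (n + 1)).image (fun j => (0, j)) ⊆ D := by
      intro p hp
      obtain ⟨j, _, rfl⟩ := Finset.mem_image.1 hp
      exact (hD 0 j).2 (Nat.pos_of_ne_zero (h j))
    have := Finset.card_le_card hsub
    rw [Finset.card_image_of_injective _ (Prod.mk_right_injective 0), Finset.card_range] at this
    omega
  set m := Nat.find hz with hm
  have hlt : ∀ j < m, 0 < r j := fun j hj => Nat.pos_of_ne_zero (Nat.find_min hz hj)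
  have hge : ∀ j, m ≤ j → r j = 0 := fun j hj =>
    Nat.le_zero.1 ((hr hj).trans_eq (Nat.find_spec hz))
  set l := (List.range m).map r with hl
  have hgetD : ∀ j, l.getD j 0 = r j := by
    intro j
    rcases Nat.lt_or_ge j m with hj | hj
    · simp [hl, hj]
    · rw [hge j hj]
      simp [hl, hj]
  have hDL : (diagramCells 0 l).toFinset = D := by
    ext ⟨k, j⟩
    rw [List.mem_toFinset, mem_diagramCells, hD, Nat.sub_zero, hgetD]
    simp
  have hsum : l.sum = n := by
    rw [← length_diagramCells l 0, ← List.toFinset_card_of_nodup (nodup_diagramCells l 0), hDL,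
      hcard]
  have hle : ∀ x ∈ l, 0 < x ∧ x ≤ n := by
    intro x hx
    refine ⟨?_, (List.le_sum_of_mem hx).trans_eq hsum⟩
    obtain ⟨j, hj, rfl⟩ := List.mem_map.1 hx
    exact hlt j (List.mem_range.1 hj)
  have hs : l.Pairwise (· ≥ ·) :=
    List.Pairwise.map r (fun a b (h : a < b) => hr h.le) List.pairwise_lt_range
  have halt := altSum_add_altSum_tail l
  rw [hsum] at halt
  obtain ⟨c, hc⟩ := exists_fill _ n n 0 0 l le_rfl le_rfl hle hs (by simp; omega)
  rw [Nat.sub_self, show altSum l.tail = n - altSum l by omega] at hc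
  have he : altSum l ≤ n := by omega
  refine ⟨altSum l, he, _, c, hc, ?_⟩
  have := (hc.town he).2.2.2
  rw [hDL] at this
  linarith

/-! ### Optimality of the output and the running time -/

theorem exists_town (n : ℕ) : ∃ S : Finset (ℤ × ℤ), S.card = n :=
  Infinite.exists_subset_card_eq _ n

/-- Any competing town has a diagram whose filling costs no more than the town, and the printed
filling costs no more than that one. -/
theorem exec_optimal (n : ℕ) : ∃ s t S, RamExec ((n + 2) ^ 7) townProg (RamState.init n) s t ∧
    t ≤ 3000 * (n + 1) ^ 6 ∧ ListsTown s.out S ∧ IsOptimalTown n S := by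
  obtain ⟨S₀, hS₀⟩ := exists_town n
  have hstart : ∃ e ≤ n, 0 < startValue n e := by
    obtain ⟨e, he, L, c, hF, -⟩ := exists_fill_le S₀
    rw [hS₀] at he hF
    refine ⟨e, he, ?_⟩
    have h₁ := hF.le_bestFill ((n + 1) ^ 6)
    have h₂ := hF.cost_le
    -- Every cost stays strictly below `M = (n + 1) ^ 6`, so a feasible start has a positive value.
    have h₃ : (n + n) * n ^ 2 < (n + 1) ^ 6 := by
      have : (n + 1) ^ 3 ≤ (n + 1) ^ 6 := Nat.pow_le_pow_right (by omega) (by omega)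
      have h : (1 + n) ^ 6 = (1 + n) ^ 3 * (1 + n) ^ 3 := by ring
      nlinarith [Nat.zero_le (n ^ 2), Nat.zero_le (n ^ 3), Nat.zero_le (n ^ 4),
        Nat.zero_le (n ^ 5), Nat.zero_le (n ^ 6)]
    unfold startValue
    omega
  obtain ⟨s, t, e, L, c, hE, ht, hout, he, hF, hbest⟩ := exec_townProg hstart
  obtain ⟨hlist, hcard, hcost, -⟩ := hF.town he
  refine ⟨s, t, placedTown n L, hE, ht, hout ▸ hlist, hcard, fun S' hS' => ?_⟩
  obtain ⟨e', he', L', c', hF', hc'⟩ := exists_fill_le S'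
  rw [hS'] at he' hF'
  have h₁ := hF'.le_bestFill ((n + 1) ^ 6)
  have h₂ := hbest e' he'
  unfold startValue at h₂
  have h₃ : (c : ℚ) ≤ c' := by
    have : c ≤ c' := by omega
    exact_mod_cast this
  rw [hcost]
  exact h₃.trans hc'

theorem isBigO_of_le {T : ℕ → ℕ} (hT : ∀ n, T n ≤ 3000 * (n + 1) ^ 6) :
    (fun n : ℕ => (T n : ℝ)) =O[atTop] (fun n : ℕ => (n : ℝ) ^ (15 / 2 : ℝ)) := by
  refine IsBigO.of_bound (3000 * 2 ^ 6) ?_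
  filter_upwards [eventually_ge_atTop 1] with n hn
  have hn' : (1 : ℝ) ≤ n := by exact_mod_cast hn
  rw [Real.norm_of_nonneg (by positivity), Real.norm_of_nonneg (by positivity)]
  have h₁ : (T n : ℝ) ≤ 3000 * ((n : ℝ) + 1) ^ 6 := by exact_mod_cast hT n
  have h₂ : ((n : ℝ) + 1) ^ 6 ≤ (2 * n) ^ 6 := by gcongr; linarith
  have h₃ : (n : ℝ) ^ 6 ≤ (n : ℝ) ^ (15 / 2 : ℝ) := by
    rw [← Real.rpow_natCast]
    exact Real.rpow_le_rpow_of_exponent_le hn' (by norm_num)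
  calc (T n : ℝ) ≤ 3000 * (2 * n) ^ 6 := h₁.trans (by gcongr)
    _ = 3000 * 2 ^ 6 * (n : ℝ) ^ 6 := by ring
    _ ≤ _ := by gcongr

/-- One program computes an optimal `n`-town on every input `n`, in `O(n ^ (15 / 2))` elementary
steps on words of `O(log n)` bits: all numbers that occur are at most `(n + 2) ^ k`, for a fixed
`k`. -/
theorem theorem1 :
    ∃ (P : RamProg) (k : ℕ) (T : ℕ → ℕ),
      (fun n : ℕ => (T n : ℝ)) =O[atTop] (fun n : ℕ => (n : ℝ) ^ (15 / 2 : ℝ)) ∧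
      ∀ n : ℕ, ∃ (s : RamState) (S : Finset (ℤ × ℤ)),
        RamExec ((n + 2) ^ k) P (RamState.init n) s (T n) ∧
        ListsTown s.out S ∧ IsOptimalTown n S := by
  choose s T S hE hT hL hO using exec_optimal
  exact ⟨townProg, 7, T, isBigO_of_le hT, fun n => ⟨s n, S n, hE n, hL n, hO n⟩⟩
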